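/- **Setting.** There are $n$ nodes $P_1,\dots,P_n$. A set $B$ of at most $f$ nodes, $3f<n$, is Byzantine and is fixed before the protocol starts; the others are honest. Fix integers $\varphi\ge 1$ and $0\le n_c\le n$. For every sender $P_i$ and every residue $k$ modulo $\varphi$ a committee $C_{i,k}$ is drawn, all independently, each uniformly from the $n_c$-element sets of nodes; $C(i,r):=C_{i,\,r\bmod\varphi}$ is the public committee of $P_i$ for round $r\ge1$. Nodes communicate by messages; every message sent to an honest node is eventually received, with no bound on delays. Signatures are idealized: nobody can produce a signed message of an honest sender which that sender has not created, nor a signature share which an honest node has not generated. A certificate $\mathrm{cert}(m)$ for a round-$r$ message $m$ of $P_i$ consists of signature shares on (the sender, round and hash of) $m$ from at least $\lfloor n_c/2\rfloor+1$ distinct members of $C(i,r)$. A node obtains it from these shares, or from $P_i$. **Protocol (APM-BRB).** Every node $P_i$ has an input for every round $r=1,2,\dots$. Every node keeps, for each $j$, an append-only list $\mathrm{promises}[j]$ of messages of $P_j$ of rounds $1,2,\dots$, and a pair $\mathrm{triggers}[j]$ of a certificate and a round, initially empty. An honest node runs the following concurrently. * *Fetching.* To fetch the messages of $P_j$ up to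 round $r$, it requests the missing ones one after the other, either from the members of the committee of that message (mode `syncMsg`) or from $P_j$ itself (mode `reqMsg`), and appends a received message to $\mathrm{promises}[j]$ if it is of round $1$ or contains a certificate for the last message of the list; `reqMsg` also waits for a certificate for the message of round $r$. Requests are answered with the requested message (and certificate) as soon as the node has it. * *Sending.* In round $1$, $P_i$ sends its message $m^i_1$ (its input and $\mathrm{triggers}$) to $C(i,1)$. In round $r\ge2$ it invokes `reqMsg` up to round $r-1$ for all $j$, waits until it has $\mathrm{cert}(m^i_{r-1})$ and until $2f+1$ of these invocations have completed, and sends $m^i_r$, consisting of its input for round $r$, $\mathrm{cert}(m^i_{r-1})$, the $2f+1$ certificates $\mathrm{prev}$ for the messages $\mathrm{promises}[j][r-1]$, and $\mathrm{triggers}$, to $C(i,r)$. * *Signing.* A member of $C(i,r)$ that receives a first round-$r$ message $m$ of $P_i$ fetches by `syncMsg` the messages of $P_i$ up to round $r-1$; if $r=1$ or $m$ contains a certificate for $\mathrm{promises}[i][r-1]$, it forwards $m$ to $C(i,r)$ and sends its signature share on $m$ to all nodes. * *Delivery, first condition.* To process a certificate for a message of $P_i$ of round $r\ge\varphi$, the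 node stores it in $\mathrm{triggers}[i]$ if that is empty or has a smaller round; it then obtains from the committees, going back along the certificates contained in the messages, the messages of $P_i$ of rounds $r,r-1,\dots,1$, and calls $\mathrm{Deliver}_i(m_u,u)$ for those of rounds $u\le r-\varphi$, unless already delivered. It processes every certificate that it obtains and, on delivering a message, every certificate in the $\mathrm{triggers}$ of that message. * *Delivery, second condition.* If a certificate for a message of $P_i$ of round $r-1$ is in $\mathrm{prev}$ of certified messages of round $r$ of all $n$ nodes, or in $\mathrm{prev}$ of the delivered round-$r$ messages of $2f+1$ nodes, the node goes back along the certificates in the same way and delivers the messages of $P_i$ of rounds $r-1,\dots,1$, unless already delivered. Byzantine nodes behave arbitrarily, subject only to the idealized signatures; their behaviour and the order of message deliveries may depend on the committees. **Lemma (Validity).** Let *Validity* be the event (depending on the committees) that in every execution, for all inputs, for all honest senders $P_i$ and all rounds $r\ge1$, $P_i$ broadcasts a round-$r$ message $m$ carrying its input for round $r$, and every honest node eventually calls $\mathrm{Deliver}_i(m,r)$. Let $\varepsilon>0$. 1. If with probability at least $1-\varepsilon$ every committee $C_{i,k}$ has more than $n_c/2$ honest members, then Validity has probability at least $1-\varepsilon$.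 2. If $n_c\ge 18\log(n\varphi/\varepsilon)$ (natural logarithm), then Validity has probability at least $1-\varepsilon$. -/

import Mathlib

namespace APMBRB

/-! ## Messages, signatures and certificates -/

/-- What a signature share or a certificate speaks about: the message of `sender` in round `round`
with hash value `digest`. -/
structure Tag (n : ℕ) (D : Type*) where
  sender : Fin n
  round : ℕ
  digest : D

/-- A threshold signature, merged from the signature shares of the nodes in `signers`. An object of
this type need not be valid, see `Protocol.Valid`. -/
structure Cert (n : ℕ) (D : Type*) where
  tag : Tag n D
  signers : Finset (Fin n)

/-- A protocol message `m_r^i = {content, i, cert(m_{r-1}^i), prev{}, triggers[]}`, digitally signed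
by its sender `i`. The set `prev{}` of certificates is indexed by the node that it refers to. -/
structure Msg (n : ℕ) (V D : Type*) where
  sender : Fin n
  round : ℕ
  content : V
  cert : Option (Cert n D)
  prev : Fin n → Option (Cert n D)
  triggers : Fin n → Option (Cert n D × ℕ)

/-- The certificates that occur in a message. -/
def Msg.certs {n : ℕ} {V D : Type*} (m : Msg n V D) : Set (Cert n D) :=
  {c | m.cert = some c ∨ (∃ j, m.prev j = some c) ∨ ∃ j r, m.triggers j = some (c, r)}

/-- What is sent over the network: a message `(m_r^i, r, i)`; a signature share
`(⟨m_r^i⟩_j, r, i, j)`; a request for `m_y^i`, with or without a certificate for it; the reply to a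
request. -/
inductive Payload (n : ℕ) (V D : Type*) where
  | msg (m : Msg n V D)
  | share (tag : Tag n D) (signer : Fin n)
  | request (i : Fin n) (y : ℕ) (withCert : Bool)
  | reply (m : Msg n V D) (c : Option (Cert n D))

/-- The messages contained in a payload. -/
def Payload.msgs {n : ℕ} {V D : Type*} : Payload n V D → Set (Msg n V D)
  | .msg m => {m}
  | .share _ _ => ∅
  | .request _ _ _ => ∅
  | .reply m _ => {m}

/-- The certificates contained in a payload. -/
def Payload.certs {n : ℕ} {V D : Type*} : Payload n V D → Set (Cert n D)
  | .msg m => m.certs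
  | .share _ _ => ∅
  | .request _ _ _ => ∅
  | .reply m c => m.certs ∪ {c' | c = some c'}

/-- A payload in transit. Channels are authenticated: `src` is the node that sent it. -/
structure Packet (n : ℕ) (V D : Type*) where
  src : Fin n
  dst : Fin n
  payload : Payload n V D

/-! ## Public parameters -/

/-- The public parameters, and the streams of inputs. -/
structure Protocol (n : ℕ) (V D : Type*) where
  /-- the resilience parameter -/
  f : ℕ
  /-- the number of rounds after which committees repeat, and the length of the chain of
  certificates that is needed for delivery -/
  φ : ℕ
  /-- the committee size -/
  nc : ℕ
  /-- the committee for a sender and a round -/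
  sampleCommittee : Fin n → ℕ → Finset (Fin n)
  /-- the hash function -/
  hash : Msg n V D → D
  /-- `input i r` is what node `i` wants to broadcast in round `r` -/
  input : Fin n → ℕ → V

namespace Protocol

variable {n : ℕ} {V D : Type*} (Pr : Protocol n V D)

/-- The tag of a message, which is what is signed. -/
def tag (m : Msg n V D) : Tag n D := ⟨m.sender, m.round, Pr.hash m⟩

/-- `c` is a `(n_c/2 + 1, N_c)` threshold signature, `N_c` being the committee of its tag. -/
def Valid (c : Cert n D) : Prop :=
  c.signers ⊆ Pr.sampleCommittee c.tag.sender c.tag.round ∧ Pr.nc / 2 + 1 ≤ c.signers.card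

/-- `c` is a valid threshold signature for `m`. -/
def Certifies (c : Cert n D) (m : Msg n V D) : Prop := Pr.Valid c ∧ c.tag = Pr.tag m

end Protocol

/-! ## The state of an honest node -/

/-- A walk backwards along the chain of `sender`: the next message to obtain is that of round
`round`, certified by `cert`; messages of rounds `≤ top` are delivered. -/
structure Walk (n : ℕ) (D : Type*) where
  sender : Fin n
  round : ℕ
  cert : Cert n D
  top : ℕ

/-- The local state of an honest node. -/
structure Local (n : ℕ) (V D : Type*) where
  /-- the payloads received so far, each with the node it came from -/
  inbox : Set (Fin n × Payload n V D)
  /-- the messages that the node itself has broadcast, in the order of rounds `1, 2, …` -/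
  own : List (Msg n V D)
  /-- the first message received for sender `i` and round `r`, if the node is in that committee -/
  store : Fin n → ℕ → Option (Msg n V D)
  /-- `promises[i]` is the list of messages of rounds `1, 2, …` of `i` that the node endorses -/
  promises : Fin n → List (Msg n V D)
  /-- the invocations `fetchMsg(r, i, useCommittee)` made so far, as triples `(i, r, useCommittee)` -/
  calls : Set (Fin n × ℕ × Bool)
  /-- the tags on which the node has generated a signature share -/
  signed : Set (Tag n D)
  triggers : Fin n → Option (Cert n D × ℕ)
  /-- the walks backwards along certificate chains that have been started or continued so far -/
  walks : Set (Walk n D)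
  /-- `delivered i r = some m` once the node has called `Deliver_i(m, r)` -/
  delivered : Fin n → ℕ → Option (Msg n V D)

/-- The state in which every node starts. -/
def Local.start (n : ℕ) (V D : Type*) : Local n V D where
  inbox := ∅
  own := []
  store := fun _ _ => none
  promises := fun _ => []
  calls := ∅
  signed := ∅
  triggers := fun _ => none
  walks := ∅
  delivered := fun _ _ => none

/-- The node has received `m` in a reply from one of the nodes in `S`. -/
def Local.Obtained {n : ℕ} {V D : Type*} (ℓ : Local n V D) (S : Finset (Fin n)) (m : Msg n V D) :
    Prop :=
  ∃ src ∈ S, ∃ c, (src, Payload.reply m c) ∈ ℓ.inbox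

namespace Protocol

variable {n : ℕ} {V D : Type*} (Pr : Protocol n V D)

/-- The node has obtained the certificate `c`: it is valid, and the node has received all the shares
that it merges, or has received it from the node whose message it certifies. -/
def Holds (ℓ : Local n V D) (c : Cert n D) : Prop :=
  Pr.Valid c ∧
    ((∀ s ∈ c.signers, ∃ src, (src, Payload.share c.tag s) ∈ ℓ.inbox) ∨
      ∃ m, (c.tag.sender, Payload.reply m (some c)) ∈ ℓ.inbox)

/-- Those whom `fetchMsg` asks for `m_y^i`: the committee, or `P_i` alone. -/
def fetchFrom (i : Fin n) (y : ℕ) (useCommittee : Bool) : Finset (Fin n) :=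
  if useCommittee then Pr.sampleCommittee i y else {i}

/-- The invocation `reqMsg(r, j)` has completed, with `c` a certificate for `promises[j][r]`. -/
def ReqDone (ℓ : Local n V D) (j : Fin n) (r : ℕ) (c : Cert n D) : Prop :=
  (j, r, false) ∈ ℓ.calls ∧ Pr.Holds ℓ c ∧
    ∃ m, (ℓ.promises j)[r - 1]? = some m ∧ Pr.Certifies c m

open Classical in
/-- The procedure `processCertificate(i, r, cert)`, up to the first message that it waits for. -/
noncomputable def processCertificate (i : Fin n) (r : ℕ) (c : Cert n D) (ℓ : Local n V D) :
    Local n V D :=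
  if Pr.φ ≤ r then
    { ℓ with
      triggers :=
        if ∀ x ∈ ℓ.triggers i, x.2 < r then Function.update ℓ.triggers i (some (c, r))
        else ℓ.triggers
      walks := insert ⟨i, r, c, r - Pr.φ⟩ ℓ.walks }
  else ℓ

open Classical in
/-- Call `Deliver_i(m, r)` if nothing has been delivered for `i` and `r` yet; the call makes the node
handle all certificates in `m.triggers[]`. -/
noncomputable def deliver (i : Fin n) (r : ℕ) (m : Msg n V D) (ℓ : Local n V D) : Local n V D :=
  if ℓ.delivered i r = none then
    (List.finRange n).foldl
      (fun ℓ' j => match m.triggers j with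
        | none => ℓ'
        | some (c, r') => Pr.processCertificate j r' c ℓ')
      { ℓ with delivered := Function.update ℓ.delivered i (Function.update (ℓ.delivered i) r (some m)) }
  else ℓ

end Protocol

/-! ## The actions of an honest node -/

/-- The atomic actions of an honest node. All invocations of functions and handlers run
concurrently; a `wait` in one of them does not block the others. -/
inductive Act (n : ℕ) (V D : Type*) where
  /-- receive a payload -/
  | recv (src : Fin n) (π : Payload n V D)
  /-- having sent the message of round `r - 1`, invoke `reqMsg(r - 1, j)` for all `j` -/
  | invoke
  /-- create the message of the next round and send it to its committee -/
  | send (cert : Option (Cert n D)) (prev : Fin n → Option (Cert n D))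
  /-- on a received message of `i` for round `r`, invoke `syncMsg(r - 1, i)` -/
  | sync (i : Fin n) (r : ℕ)
  /-- within `fetchMsg(r, i, useCommittee)`: request the first message missing in `promises[i]` -/
  | fetch (i : Fin n) (r : ℕ) (useCommittee : Bool)
  /-- within `fetchMsg(r, i, useCommittee)`: append the message waited for to `promises[i]` -/
  | promise (i : Fin n) (r : ℕ) (useCommittee : Bool) (m : Msg n V D)
  /-- answer a request -/
  | answer (dst : Fin n) (withCert : Bool) (m : Msg n V D) (c : Option (Cert n D))
  /-- as a member of the committee, forward and sign a message -/
  | sign (m : Msg n V D)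
  /-- first delivery condition: process a certificate that has been obtained -/
  | certify (c : Cert n D)
  /-- request the next message of a walk -/
  | walkRequest (w : Walk n D)
  /-- having obtained the next message of a walk, deliver it if due, and go on with the walk -/
  | walkStep (w : Walk n D) (m : Msg n V D)
  /-- second delivery condition, optimistic part: collect the messages of round `r` of all nodes -/
  | collect (r : ℕ)
  /-- second delivery condition, optimistic part: `c` is in `prev{}` of all messages of a round -/
  | fast (c : Cert n D)
  /-- second delivery condition, other part: `c` is in `prev{}` of the messages delivered for the
  `2f+1` nodes in `Q` and one round -/
  | slow (Q : Finset (Fin n)) (c : Cert n D)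

namespace Protocol

variable {n : ℕ} {V D : Type*} (Pr : Protocol n V D)

/-- When an action of node `p` is enabled. (Receiving moreover needs the packet in the network.) -/
def Guard (p : Fin n) (ℓ : Local n V D) : Act n V D → Prop
  | .recv _ _ => True
  | .invoke => ℓ.own ≠ []
  | .send cert prev =>
      (ℓ.own = [] ∧ cert = none ∧ prev = fun _ => none) ∨
      (∃ m c, ℓ.own.getLast? = some m ∧ cert = some c ∧ Pr.Holds ℓ c ∧ Pr.Certifies c m ∧
        ∃ J : Finset (Fin n), J.card = 2 * Pr.f + 1 ∧
          (∀ j ∈ J, ∃ c', prev j = some c' ∧ Pr.ReqDone ℓ j ℓ.own.length c') ∧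
          ∀ j, j ∉ J → prev j = none)
  | .sync i r => 2 ≤ r ∧ ∃ m, ℓ.store i r = some m
  | .fetch i r b => (i, r, b) ∈ ℓ.calls ∧ (ℓ.promises i).length < r
  | .promise i r b m =>
      (i, r, b) ∈ ℓ.calls ∧ (ℓ.promises i).length < r ∧
      m.sender = i ∧ m.round = (ℓ.promises i).length + 1 ∧
      ℓ.Obtained (Pr.fetchFrom i m.round b) m ∧
      -- for `m.round > 1`, the message contains a valid certificate for the message before it
      (∀ m' ∈ (ℓ.promises i).getLast?, ∃ c, m.cert = some c ∧ Pr.Certifies c m') ∧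
      -- `reqMsg` also waits for a certificate for the last message
      (m.round = r ∧ b = false → ∃ c, Pr.Holds ℓ c ∧ Pr.Certifies c m)
  | .answer dst withCert m c =>
      (dst, Payload.request m.sender m.round withCert) ∈ ℓ.inbox ∧
      ((p = m.sender ∧ m ∈ ℓ.own) ∨ ℓ.store m.sender m.round = some m) ∧
      (withCert = true → ∃ c', c = some c' ∧ Pr.Holds ℓ c' ∧ Pr.Certifies c' m) ∧
      (withCert = false → c = none)
  | .sign m =>
      ℓ.store m.sender m.round = some m ∧
      (m.round = 1 ∨
        (2 ≤ m.round ∧ (m.sender, m.round - 1, true) ∈ ℓ.calls ∧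
          ∃ c m', m.cert = some c ∧ (ℓ.promises m.sender)[m.round - 2]? = some m' ∧
            Pr.Certifies c m'))
  | .certify c => Pr.Holds ℓ c
  | .walkRequest w => w ∈ ℓ.walks ∧ 1 ≤ w.round
  | .walkStep w m =>
      w ∈ ℓ.walks ∧ 1 ≤ w.round ∧ m.sender = w.sender ∧ m.round = w.round ∧
      ℓ.Obtained (Pr.sampleCommittee w.sender w.round) m ∧ Pr.Certifies w.cert m
  | .collect r => ∀ j, ∃ c, Pr.Holds ℓ c ∧ c.tag.sender = j ∧ c.tag.round = r
  | .fast c =>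
      ∃ M : Fin n → Msg n V D,
        (∀ j, (M j).sender = j ∧ (M j).round = c.tag.round + 1 ∧
          ℓ.Obtained (Pr.sampleCommittee j (c.tag.round + 1)) (M j) ∧
          (∃ c', Pr.Holds ℓ c' ∧ Pr.Certifies c' (M j)) ∧
          ∃ c', (M j).prev c.tag.sender = some c' ∧ c'.tag = c.tag) ∧
        ∃ j, (M j).prev c.tag.sender = some c
  | .slow Q c =>
      Q.card = 2 * Pr.f + 1 ∧
      (∀ j ∈ Q, ∃ m c', ℓ.delivered j (c.tag.round + 1) = some m ∧
        m.prev c.tag.sender = some c' ∧ c'.tag = c.tag) ∧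
      ∃ j ∈ Q, ∃ m, ℓ.delivered j (c.tag.round + 1) = some m ∧ m.prev c.tag.sender = some c

/-- The message that node `p` creates for its next round. -/
def nextMsg (p : Fin n) (ℓ : Local n V D) (cert : Option (Cert n D))
    (prev : Fin n → Option (Cert n D)) : Msg n V D where
  sender := p
  round := ℓ.own.length + 1
  content := Pr.input p (ℓ.own.length + 1)
  cert := cert
  prev := prev
  triggers := ℓ.triggers

open Classical in
/-- What an action of node `p` does to its state. -/
noncomputable def effect (p : Fin n) (ℓ : Local n V D) : Act n V D → Local n V D
  | .recv src π =>
      { ℓ with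
        inbox := insert (src, π) ℓ.inbox
        store := match π with
          | .msg m =>
              if 1 ≤ m.round ∧ p ∈ Pr.sampleCommittee m.sender m.round ∧
                  ℓ.store m.sender m.round = none then
                Function.update ℓ.store m.sender
                  (Function.update (ℓ.store m.sender) m.round (some m))
              else ℓ.store
          | _ => ℓ.store }
  | .invoke => { ℓ with calls := ℓ.calls ∪ {x | ∃ j, x = (j, ℓ.own.length, false)} }
  | .send cert prev => { ℓ with own := ℓ.own ++ [Pr.nextMsg p ℓ cert prev] }
  | .sync i r => { ℓ with calls := insert (i, r - 1, true) ℓ.calls }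
  | .fetch _ _ _ => ℓ
  | .promise i _ _ m => { ℓ with promises := Function.update ℓ.promises i (ℓ.promises i ++ [m]) }
  | .answer _ _ _ _ => ℓ
  | .sign m => { ℓ with signed := insert (Pr.tag m) ℓ.signed }
  | .certify c => Pr.processCertificate c.tag.sender c.tag.round c ℓ
  | .walkRequest _ => ℓ
  | .walkStep w m =>
      let ℓ' := if w.round ≤ w.top then Pr.deliver w.sender w.round m ℓ else ℓ
      match m.cert with
      | none => ℓ'
      | some c => { ℓ' with walks := insert ⟨w.sender, w.round - 1, c, w.top⟩ ℓ'.walks }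
  | .collect _ => ℓ
  | .fast c =>
      { ℓ with walks := insert ⟨c.tag.sender, c.tag.round, c, c.tag.round⟩ ℓ.walks }
  | .slow _ c =>
      { ℓ with walks := insert ⟨c.tag.sender, c.tag.round, c, c.tag.round⟩ ℓ.walks }

/-- The packets that an action of node `p` puts into the network. -/
def output (p : Fin n) (ℓ : Local n V D) : Act n V D → Set (Packet n V D)
  | .recv _ _ => ∅
  | .invoke => ∅
  | .send cert prev =>
      {x | ∃ q ∈ Pr.sampleCommittee p (ℓ.own.length + 1),
        x = ⟨p, q, .msg (Pr.nextMsg p ℓ cert prev)⟩}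
  | .sync _ _ => ∅
  | .fetch i r b =>
      {x | ∃ q ∈ Pr.fetchFrom i ((ℓ.promises i).length + 1) b,
        x = ⟨p, q, .request i ((ℓ.promises i).length + 1)
          (!b && decide ((ℓ.promises i).length + 1 = r) && decide (r ≠ 1))⟩}
  | .promise _ _ _ _ => ∅
  | .answer dst _ m c => {⟨p, dst, .reply m c⟩}
  | .sign m =>
      {x | ∃ q ∈ Pr.sampleCommittee m.sender m.round, x = ⟨p, q, .msg m⟩} ∪
      {x | ∃ q, x = ⟨p, q, .share (Pr.tag m) p⟩}
  | .certify _ => ∅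
  | .walkRequest w =>
      {x | ∃ q ∈ Pr.sampleCommittee w.sender w.round,
        x = ⟨p, q, .request w.sender w.round false⟩}
  | .walkStep _ _ => ∅
  | .collect r =>
      {x | ∃ j, ∃ q ∈ Pr.sampleCommittee j r, x = ⟨p, q, .request j r false⟩}
  | .fast _ => ∅
  | .slow _ _ => ∅

end Protocol

/-! ## Executions -/

/-- A global state: the packets sent so far, and the local states (of no meaning for Byzantine
nodes). -/
structure Config (n : ℕ) (V D : Type*) where
  net : Set (Packet n V D)
  loc : Fin n → Local n V D

/-- The state in which every execution starts. -/
def Config.start (n : ℕ) (V D : Type*) : Config n V D := ⟨∅, fun _ => Local.start n V D⟩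

/-- The adversary can produce the payload `π` in state `s` without breaking cryptography: every
message of an honest sender in it has been created by that sender, and every signature share of an
honest node in it, also within a certificate, has been generated by that node. -/
def CanProduce {n : ℕ} {V D : Type*} (Byz : Finset (Fin n)) (s : Config n V D)
    (π : Payload n V D) : Prop :=
  (∀ m ∈ π.msgs, m.sender ∉ Byz → m ∈ (s.loc m.sender).own) ∧
  (∀ c ∈ π.certs, ∀ q ∈ c.signers, q ∉ Byz → c.tag ∈ (s.loc q).signed) ∧
  (∀ tag q, π = .share tag q → q ∉ Byz → tag ∈ (s.loc q).signed)

namespace Protocol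

variable {n : ℕ} {V D : Type*} (Pr : Protocol n V D)

/-- Node `p` can perform the action `a` in state `s`. -/
def Enabled (s : Config n V D) (p : Fin n) (a : Act n V D) : Prop :=
  Pr.Guard p (s.loc p) a ∧ ∀ src π, a = .recv src π → (⟨src, p, π⟩ : Packet n V D) ∈ s.net

/-- The state after node `p` has performed the action `a` in state `s`. -/
noncomputable def perform (s : Config n V D) (p : Fin n) (a : Act n V D) : Config n V D where
  net := s.net ∪ Pr.output p (s.loc p) a
  loc := Function.update s.loc p (Pr.effect p (s.loc p) a)

/-- One step: nothing happens, or an honest node performs an enabled action, or a Byzantine node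
sends to any node anything that it can produce. -/
inductive Step (Byz : Finset (Fin n)) (s : Config n V D) : Config n V D → Prop
  | idle : Step Byz s s
  | honest (p : Fin n) (a : Act n V D) (hp : p ∉ Byz) (ha : Pr.Enabled s p a) :
      Step Byz s (Pr.perform s p a)
  | byzantine (p q : Fin n) (π : Payload n V D) (hp : p ∈ Byz) (hπ : CanProduce Byz s π) :
      Step Byz s { s with net := insert ⟨p, q, π⟩ s.net }

/-- An infinite execution in which the nodes in `Byz` are Byzantine: whatever an honest node can do
from some point on, it does eventually. In particular every packet sent to an honest node is
received eventually; there is no bound on delays. -/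
structure IsExecution (Byz : Finset (Fin n)) (σ : ℕ → Config n V D) : Prop where
  start : σ 0 = Config.start n V D
  step : ∀ t, Pr.Step Byz (σ t) (σ (t + 1))
  fair : ∀ p, p ∉ Byz → ∀ a t, (∀ t' ≥ t, Pr.Enabled (σ t') p a) →
    ∃ t' ≥ t, σ (t' + 1) = Pr.perform (σ t') p a

/-- Validity, for all honest senders `i` and all rounds `r ≥ 1`: the sender broadcasts its input as
a message `m` of round `r`, and every honest node eventually calls `Deliver_i(m, r)`. -/
def Validity (Byz : Finset (Fin n)) (σ : ℕ → Config n V D) : Prop :=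
  ∀ i, i ∉ Byz → ∀ r, 1 ≤ r →
    ∃ m : Msg n V D, m.content = Pr.input i r ∧ (∃ t, ((σ t).loc i).own[r - 1]? = some m) ∧
      ∀ j, j ∉ Byz → ∃ t, ((σ t).loc j).delivered i r = some m

end Protocol

/-! ## Random committees -/

/-- A committee of `nc` nodes for each sender and each residue of the round modulo `φ`. -/
abbrev Sampling (n φ nc : ℕ) : Type := Fin n → Fin φ → {S : Finset (Fin n) // S.card = nc}

theorem Sampling.nonempty {n nc : ℕ} (φ : ℕ) (h : nc ≤ n) : Nonempty (Sampling n φ nc) := by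
  obtain ⟨S, -, hS⟩ := Finset.exists_subset_card_eq (s := (Finset.univ : Finset (Fin n))) (n := nc)
    (by simpa using h)
  exact ⟨fun _ _ => ⟨S, hS⟩⟩

/-- All committees are drawn independently, each uniformly from the sets of `nc` nodes. -/
noncomputable def samplingLaw {n nc : ℕ} (φ : ℕ) (h : nc ≤ n) : PMF (Sampling n φ nc) :=
  haveI := Sampling.nonempty φ h
  PMF.uniformOfFintype _

/-- The probability of an event that is determined by the committees. -/
noncomputable def prob {n nc : ℕ} (φ : ℕ) (h : nc ≤ n) (E : Set (Sampling n φ nc)) : ENNReal :=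
  (samplingLaw φ h).toOuterMeasure E

/-- Every committee has a majority of honest nodes. -/
def HonestMajority {n φ nc : ℕ} (Byz : Finset (Fin n)) (com : Sampling n φ nc) : Prop :=
  ∀ i k, nc < 2 * ((com i k).1 \ Byz).card

/-- The protocol with given committees; the committee of round `r` is that of `r mod φ`. -/
def protocol {n φ nc : ℕ} [NeZero φ] {V D : Type*} (f : ℕ) (hash : Msg n V D → D)
    (com : Sampling n φ nc) (input : Fin n → ℕ → V) : Protocol n V D where
  f := f
  φ := φ
  nc := nc
  sampleCommittee := fun i r => (com i (Fin.ofNat φ r)).1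
  hash := hash
  input := input

/-- The event that validity holds in every execution: whatever the inputs, the order and delays of
deliveries, and the behaviour of the Byzantine nodes (all of which may depend on the committees). -/
def ValidityEvent {n : ℕ} {V D : Type*} (f φ nc : ℕ) [NeZero φ] (hash : Msg n V D → D)
    (Byz : Finset (Fin n)) : Set (Sampling n φ nc) :=
  {com | ∀ (input : Fin n → ℕ → V) (σ : ℕ → Config n V D),
    (protocol f hash com input).IsExecution Byz σ → (protocol f hash com input).Validity Byz σ}

end APMBRB

/-! ### Persistence of the recorded data -/

namespace APMBRB

/-! Randomness matters only through one event: if each committee has an honest majority, every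
execution is valid, whatever the adversary does (`honestMajority_subset_validityEvent`). Part 1 is
then monotonicity of probability, and part 2 needs a tail bound for that event.

Deterministic half. What an honest node records persists, so fairness yields any goal whose action
stays enabled. An honest sender creates one message per round and its signature cannot be forged, so
whatever is stored, promised or delivered for it is the right message (`IsExecution.eq_of_genuine`).
Rounds progress by induction, for all honest senders at once (`IsExecution.exists_broadcasts`):
honest committee members store the message, fetch its predecessors and sign; their shares alone form
a certificate (`IsExecution.eventuallyCertified`); and the at least `2f+1` honest nodes supply the
`prev` entries for the next message. The first delivery condition suffices: the certificate for the
message `φ` rounds later starts a walk that descends to the required round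
(`IsExecution.eventually_delivered_of_walk`).

Probabilistic half. At most a third of the nodes are Byzantine, so `2 ^ #(S ∩ B)` has mean at most
`(4/3) ^ nc` for a uniform committee `S`. Markov's inequality gives the failure probability `exp
(-nc / 18)` for one committee, and a union bound covers all `n * φ` of them. -/

/-- The local state `ℓ'` extends `ℓ`: nothing recorded in `ℓ` has been lost or changed. -/
structure Local.Extends {n : ℕ} {V D : Type*} (ℓ ℓ' : Local n V D) : Prop where
  inbox : ℓ.inbox ⊆ ℓ'.inbox
  own : ℓ.own <+: ℓ'.own
  store : ∀ i r m, ℓ.store i r = some m → ℓ'.store i r = some m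
  promises : ∀ i, ℓ.promises i <+: ℓ'.promises i
  calls : ℓ.calls ⊆ ℓ'.calls
  walks : ℓ.walks ⊆ ℓ'.walks
  delivered : ∀ i r m, ℓ.delivered i r = some m → ℓ'.delivered i r = some m

/-- The order leaves out `triggers`, the one field whose entries are overwritten. With it,
persistence of a fact becomes `Monotone`. -/
instance {n : ℕ} {V D : Type*} : Preorder (Local n V D) where
  le := Local.Extends
  le_refl _ := ⟨subset_rfl, List.prefix_rfl, fun _ _ _ => id, fun _ => List.prefix_rfl,
    subset_rfl, subset_rfl, fun _ _ _ => id⟩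
  le_trans _ _ _ h h' := ⟨h.inbox.trans h'.inbox, h.own.trans h'.own,
    fun i r m e => h'.store i r m (h.store i r m e),
    fun i => (h.promises i).trans (h'.promises i), h.calls.trans h'.calls,
    h.walks.trans h'.walks, fun i r m e => h'.delivered i r m (h.delivered i r m e)⟩

instance {n : ℕ} {V D : Type*} : Preorder (Config n V D) where
  le s s' := s.net ⊆ s'.net ∧ ∀ p, s.loc p ≤ s'.loc p
  le_refl _ := ⟨subset_rfl, fun _ => le_rfl⟩
  le_trans _ _ _ h h' := ⟨h.1.trans h'.1, fun p => (h.2 p).trans (h'.2 p)⟩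

theorem List.IsPrefix.getElem?_eq_some {α : Type*} {l l' : List α} (h : l <+: l') {k : ℕ} {a : α}
    (hk : l[k]? = some a) : l'[k]? = some a := by
  obtain ⟨l'', rfl⟩ := h
  rw [List.getElem?_append_left (List.getElem?_eq_some_iff.1 hk).1, hk]

namespace Protocol

variable {n : ℕ} {V D : Type*} (Pr : Protocol n V D)

theorem le_processCertificate (i : Fin n) (r : ℕ) (c : Cert n D) (ℓ : Local n V D) :
    ℓ ≤ Pr.processCertificate i r c ℓ := by
  unfold processCertificate
  split_ifs <;> exact ⟨subset_rfl, List.prefix_rfl, fun _ _ _ => id, fun _ => List.prefix_rfl,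
    subset_rfl, by simp, fun _ _ _ => id⟩

/-- Processing certificates changes neither of the records of messages. -/
theorem processCertificate_messages (i : Fin n) (r : ℕ) (c : Cert n D) (ℓ : Local n V D) :
    (Pr.processCertificate i r c ℓ).inbox = ℓ.inbox ∧
    (Pr.processCertificate i r c ℓ).own = ℓ.own ∧
    (Pr.processCertificate i r c ℓ).store = ℓ.store ∧
    (Pr.processCertificate i r c ℓ).promises = ℓ.promises ∧
    (Pr.processCertificate i r c ℓ).delivered = ℓ.delivered := by
  unfold processCertificate
  split_ifs <;> simp

theorem foldl_processCertificate (m : Msg n V D) (js : List (Fin n)) (ℓ : Local n V D) :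
    let ℓ' := js.foldl (fun ℓ' j => match m.triggers j with
        | none => ℓ'
        | some (c, r') => Pr.processCertificate j r' c ℓ') ℓ
    ℓ ≤ ℓ' ∧ ℓ'.inbox = ℓ.inbox ∧ ℓ'.own = ℓ.own ∧ ℓ'.store = ℓ.store ∧
      ℓ'.promises = ℓ.promises ∧ ℓ'.delivered = ℓ.delivered := by
  induction js generalizing ℓ with
  | nil => simp
  | cons j js ih =>
    rw [List.foldl_cons]
    rcases h : m.triggers j with _ | ⟨c, r'⟩
    · simpa only using ih ℓ
    · obtain ⟨h1, h2⟩ := ih (Pr.processCertificate j r' c ℓ)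
      obtain ⟨e1, e2, e3, e4, e5⟩ := Pr.processCertificate_messages j r' c ℓ
      refine ⟨(Pr.le_processCertificate j r' c ℓ).trans h1, ?_⟩
      simpa only [e1, e2, e3, e4, e5] using h2

open Classical in
theorem deliver_messages (i : Fin n) (r : ℕ) (m : Msg n V D) (ℓ : Local n V D) :
    ℓ ≤ Pr.deliver i r m ℓ ∧ (Pr.deliver i r m ℓ).inbox = ℓ.inbox ∧
    (Pr.deliver i r m ℓ).own = ℓ.own ∧ (Pr.deliver i r m ℓ).store = ℓ.store ∧
    (Pr.deliver i r m ℓ).promises = ℓ.promises ∧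
    (Pr.deliver i r m ℓ).delivered = if ℓ.delivered i r = none then
      Function.update ℓ.delivered i (Function.update (ℓ.delivered i) r (some m))
      else ℓ.delivered := by
  unfold deliver
  split_ifs with h
  · obtain ⟨h1, h2⟩ := Pr.foldl_processCertificate m (List.finRange n)
      { ℓ with delivered := Function.update ℓ.delivered i
                (Function.update (ℓ.delivered i) r (some m)) }
    refine ⟨le_trans ?_ h1, h2⟩
    refine ⟨subset_rfl, List.prefix_rfl, fun _ _ _ => id, fun _ => List.prefix_rfl,
      subset_rfl, subset_rfl, fun j u m' hm' => ?_⟩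
    -- The updated slot was empty, so an entry that was already recorded lies elsewhere.
    rcases eq_or_ne j i with rfl | hj
    · rcases eq_or_ne u r with rfl | hu
      · simp [h] at hm'
      · simpa [hu] using hm'
    · simpa [hj] using hm'
  · exact ⟨le_rfl, rfl, rfl, rfl, rfl, rfl⟩

/-- Each write to a compared field appends to a list, inserts into a set or fills an empty slot. -/
theorem le_effect (p : Fin n) (ℓ : Local n V D) (a : Act n V D) : ℓ ≤ Pr.effect p ℓ a := by
  cases a with
  | recv src π =>
    refine ⟨by simp [effect], List.prefix_rfl, fun i r m h => ?_, fun _ => List.prefix_rfl,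
      subset_rfl, subset_rfl, fun _ _ _ => id⟩
    cases π with
    | msg m' =>
      simp only [effect]
      split_ifs with hc
      · rcases eq_or_ne i m'.sender with rfl | hi
        · rcases eq_or_ne r m'.round with rfl | hr
          · simp [hc.2.2] at h
          · simpa [hr] using h
        · simpa [hi] using h
      · exact h
    | _ => exact h
  | invoke => exact ⟨subset_rfl, List.prefix_rfl, fun _ _ _ => id, fun _ => List.prefix_rfl,
      by simp [effect], subset_rfl, fun _ _ _ => id⟩
  | send => exact ⟨subset_rfl, List.prefix_append _ _, fun _ _ _ => id, fun _ => List.prefix_rfl,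
      subset_rfl, subset_rfl, fun _ _ _ => id⟩
  | sync i r => exact ⟨subset_rfl, List.prefix_rfl, fun _ _ _ => id, fun _ => List.prefix_rfl,
      by simp [effect], subset_rfl, fun _ _ _ => id⟩
  | promise i r b m =>
    refine ⟨subset_rfl, List.prefix_rfl, fun _ _ _ => id, fun j => ?_,
      subset_rfl, subset_rfl, fun _ _ _ => id⟩
    rcases eq_or_ne j i with rfl | hj
    · simp [effect]
    · simp [effect, hj]
  | certify c => exact Pr.le_processCertificate _ _ _ _
  | walkStep w m =>
    have h : ℓ ≤ if w.round ≤ w.top then Pr.deliver w.sender w.round m ℓ else ℓ := by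
      split_ifs
      · exact (Pr.deliver_messages _ _ _ _).1
      · exact le_rfl
    simp only [effect]
    rcases m.cert with _ | c
    · exact h
    · refine le_trans h ?_
      exact ⟨subset_rfl, List.prefix_rfl, fun _ _ _ => id, fun _ => List.prefix_rfl,
        subset_rfl, by simp, fun _ _ _ => id⟩
  | fast c => exact ⟨subset_rfl, List.prefix_rfl, fun _ _ _ => id, fun _ => List.prefix_rfl,
      subset_rfl, by simp [effect], fun _ _ _ => id⟩
  | slow Q c => exact ⟨subset_rfl, List.prefix_rfl, fun _ _ _ => id, fun _ => List.prefix_rfl,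
      subset_rfl, by simp [effect], fun _ _ _ => id⟩
  | sign m => exact ⟨subset_rfl, List.prefix_rfl, fun _ _ _ => id, fun _ => List.prefix_rfl,
      subset_rfl, subset_rfl, fun _ _ _ => id⟩
  | _ => exact le_refl ℓ

theorem perform_loc_self (s : Config n V D) (p : Fin n) (a : Act n V D) :
    (Pr.perform s p a).loc p = Pr.effect p (s.loc p) a := by
  simp [perform]

theorem le_perform (s : Config n V D) (p : Fin n) (a : Act n V D) : s ≤ Pr.perform s p a := by
  refine ⟨Set.subset_union_left, fun q => ?_⟩
  rcases eq_or_ne q p with rfl | hq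
  · rw [perform_loc_self]; exact Pr.le_effect _ _ _
  · simp [perform, hq]

variable {Pr} in
theorem Step.le {Byz : Finset (Fin n)} {s s' : Config n V D} (h : Pr.Step Byz s s') : s ≤ s' := by
  cases h with
  | idle => exact le_rfl
  | honest p a => exact Pr.le_perform _ _ _
  | byzantine => exact ⟨Set.subset_insert _ _, fun _ => le_rfl⟩

variable {Pr} in
theorem IsExecution.monotone {Byz : Finset (Fin n)} {σ : ℕ → Config n V D}
    (h : Pr.IsExecution Byz σ) : Monotone σ :=
  monotone_nat_of_le_succ fun t => (h.step t).le

end Protocol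

/-! ### Safety invariant: no forged messages -/

/-- The message is not a forgery: if its sender is honest, the sender has created it. -/
def Genuine {n : ℕ} {V D : Type*} (Byz : Finset (Fin n)) (s : Config n V D) (m : Msg n V D) :
    Prop :=
  m.sender ∉ Byz → m ∈ (s.loc m.sender).own

theorem Genuine.mono {n : ℕ} {V D : Type*} {Byz : Finset (Fin n)} {s s' : Config n V D}
    {m : Msg n V D} (h : Genuine Byz s m) (hs : s ≤ s') : Genuine Byz s' m :=
  fun hm => (hs.2 _).own.subset (h hm)

namespace Protocol

variable {n : ℕ} {V D : Type*} (Pr : Protocol n V D)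

/-- The messages that a node has created form a chain of certified messages of rounds `1, 2, …`. -/
def OwnChain (p : Fin n) (l : List (Msg n V D)) : Prop :=
  ∀ k m, l[k]? = some m → m.sender = p ∧ m.round = k + 1 ∧ m.content = Pr.input p (k + 1) ∧
    ∀ k', k = k' + 1 → ∃ c m', m.cert = some c ∧ l[k']? = some m' ∧ Pr.Certifies c m'

/-- The records of a local state carry the right senders and rounds, and no forged messages. -/
structure LocalInv (Byz : Finset (Fin n)) (s : Config n V D) (p : Fin n) (ℓ : Local n V D) :
    Prop where
  own : Pr.OwnChain p ℓ.own
  inbox : ∀ x ∈ ℓ.inbox, (⟨x.1, p, x.2⟩ : Packet n V D) ∈ s.net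
  store : ∀ i r m, ℓ.store i r = some m → m.sender = i ∧ m.round = r ∧ Genuine Byz s m
  promises : ∀ (i : Fin n) (k : ℕ) (m : Msg n V D), (ℓ.promises i)[k]? = some m →
    m.sender = i ∧ m.round = k + 1 ∧ Genuine Byz s m
  delivered : ∀ i r m, ℓ.delivered i r = some m → m.sender = i ∧ m.round = r ∧ Genuine Byz s m

/-- The invariant of executions. -/
structure Inv (Byz : Finset (Fin n)) (s : Config n V D) : Prop where
  loc : ∀ p, Pr.LocalInv Byz s p (s.loc p)
  net : ∀ x ∈ s.net, ∀ m ∈ x.payload.msgs, Genuine Byz s m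
  sent : ∀ p, ∀ m ∈ (s.loc p).own, ∀ q ∈ Pr.sampleCommittee p m.round,
    (⟨p, q, .msg m⟩ : Packet n V D) ∈ s.net

variable {Pr}

theorem LocalInv.mono {Byz : Finset (Fin n)} {s s' : Config n V D} {p : Fin n} {ℓ : Local n V D}
    (h : Pr.LocalInv Byz s p ℓ) (hs : s ≤ s') : Pr.LocalInv Byz s' p ℓ where
  own := h.own
  inbox x hx := hs.1 (h.inbox x hx)
  store i r m e := ⟨(h.store i r m e).1, (h.store i r m e).2.1, (h.store i r m e).2.2.mono hs⟩
  promises i k m e :=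
    ⟨(h.promises i k m e).1, (h.promises i k m e).2.1, (h.promises i k m e).2.2.mono hs⟩
  delivered i r m e :=
    ⟨(h.delivered i r m e).1, (h.delivered i r m e).2.1, (h.delivered i r m e).2.2.mono hs⟩

theorem LocalInv.genuine_of_obtained {Byz : Finset (Fin n)} {s : Config n V D} (h : Pr.Inv Byz s)
    {p : Fin n} {S : Finset (Fin n)} {m : Msg n V D} (hm : (s.loc p).Obtained S m) :
    Genuine Byz s m := by
  obtain ⟨src, -, c, hc⟩ := hm
  exact h.net _ ((h.loc p).inbox _ hc) m (by simp [Payload.msgs])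

theorem LocalInv.congr {Byz : Finset (Fin n)} {s : Config n V D} {p : Fin n} {ℓ ℓ' : Local n V D}
    (h : Pr.LocalInv Byz s p ℓ) (h1 : ℓ'.inbox = ℓ.inbox) (h2 : ℓ'.own = ℓ.own)
    (h3 : ℓ'.store = ℓ.store) (h4 : ℓ'.promises = ℓ.promises) (h5 : ℓ'.delivered = ℓ.delivered) :
    Pr.LocalInv Byz s p ℓ' :=
  ⟨by rw [h2]; exact h.own, by rw [h1]; exact h.inbox, by rw [h3]; exact h.store,
    by rw [h4]; exact h.promises, by rw [h5]; exact h.delivered⟩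

/-- Genuineness can still be measured in the old state `s`: newly stored, promised or delivered
messages come from its network, and for `own`, which `send` extends, the invariant asks only for a
chain. -/
theorem Inv.localInv_effect {Byz : Finset (Fin n)} {s : Config n V D} (h : Pr.Inv Byz s)
    {p : Fin n} {a : Act n V D} (ha : Pr.Enabled s p a) :
    Pr.LocalInv Byz s p (Pr.effect p (s.loc p) a) := by
  have hp := h.loc p
  obtain ⟨hg, hr⟩ := ha
  cases a with
  | recv src π =>
    have hnet := hr src π rfl
    refine ⟨hp.own, ?_, ?_, hp.promises, hp.delivered⟩
    · rintro x (rfl | hx)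
      · exact hnet
      · exact hp.inbox x hx
    · intro i r m hm
      cases π with
      | msg m' =>
        simp only [effect] at hm
        split_ifs at hm with hc
        · rcases eq_or_ne i m'.sender with rfl | hi
          · rcases eq_or_ne r m'.round with rfl | hr
            · simp only [Function.update_self, Option.some.injEq] at hm
              subst hm
              exact ⟨rfl, rfl, h.net _ hnet _ (by simp [Payload.msgs])⟩
            · exact hp.store _ _ _ (by simpa [hr] using hm)
          · exact hp.store _ _ _ (by simpa [hi] using hm)
        · exact hp.store _ _ _ hm
      | _ => exact hp.store _ _ _ hm
  | send cert prev =>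
    refine ⟨fun k m hm => ?_, hp.inbox, hp.store, hp.promises, hp.delivered⟩
    simp only [effect, List.getElem?_append] at hm
    split_ifs at hm with hk
    · obtain ⟨h1, h2, h3, h4⟩ := hp.own k m hm
      refine ⟨h1, h2, h3, fun k' hk' => ?_⟩
      obtain ⟨c, m', e1, e2, e3⟩ := h4 k' hk'
      exact ⟨c, m', e1, List.IsPrefix.getElem?_eq_some (List.prefix_append _ _) e2, e3⟩
    · have hk0 : k = (s.loc p).own.length := by
        have := (List.getElem?_eq_some_iff.1 hm).1
        simp at this; omega
      subst hk0
      simp only [Nat.sub_self, List.getElem?_cons_zero, Option.some.injEq] at hm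
      subst hm
      refine ⟨rfl, rfl, rfl, fun k' hk' => ?_⟩
      -- A predecessor index exists, so this is not the first round, and the guard of `send`
      -- provides a certificate for the last message.
      rcases hg with ⟨h0, -⟩ | ⟨m', c, e1, e2, -, e3, -⟩
      · simp [h0] at hk'
      · refine ⟨c, m', e2, List.IsPrefix.getElem?_eq_some (List.prefix_append _ _) ?_, e3⟩
        rw [← e1, List.getLast?_eq_getElem?, hk', Nat.add_sub_cancel]
  | promise i r b m =>
    obtain ⟨-, -, h1, h2, h3, -⟩ := hg
    refine ⟨hp.own, hp.inbox, hp.store, fun j k m' hm' => ?_, hp.delivered⟩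
    rcases eq_or_ne j i with rfl | hj
    · simp only [effect, Function.update_self, List.getElem?_append] at hm'
      split_ifs at hm' with hk
      · exact hp.promises _ _ _ hm'
      · have hk0 : k = ((s.loc p).promises j).length := by
          have := (List.getElem?_eq_some_iff.1 hm').1
          simp at this; omega
        subst hk0
        simp only [Nat.sub_self, List.getElem?_cons_zero, Option.some.injEq] at hm'
        subst hm'
        exact ⟨h1, h2, LocalInv.genuine_of_obtained h h3⟩
    · exact hp.promises j k m' (by simpa [effect, hj] using hm')
  | certify c =>
    obtain ⟨e1, e2, e3, e4, e5⟩ :=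
      Pr.processCertificate_messages c.tag.sender c.tag.round c (s.loc p)
    exact hp.congr e1 e2 e3 e4 e5
  | walkStep w m =>
    obtain ⟨-, -, h1, h2, h3, -⟩ := hg
    have hd : Pr.LocalInv Byz s p
        (if w.round ≤ w.top then Pr.deliver w.sender w.round m (s.loc p) else s.loc p) := by
      split_ifs
      · obtain ⟨-, e1, e2, e3, e4, e5⟩ := Pr.deliver_messages w.sender w.round m (s.loc p)
        refine ⟨e2 ▸ hp.own, e1 ▸ hp.inbox, e3 ▸ hp.store, e4 ▸ hp.promises, fun i r m' hm' => ?_⟩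
        rw [e5] at hm'
        split_ifs at hm'
        · rcases eq_or_ne i w.sender with rfl | hi
          · rcases eq_or_ne r w.round with rfl | hr
            · simp only [Function.update_self, Option.some.injEq] at hm'
              subst hm'
              exact ⟨h1, h2, LocalInv.genuine_of_obtained h h3⟩
            · exact hp.delivered _ _ _ (by simpa [hr] using hm')
          · exact hp.delivered _ _ _ (by simpa [hi] using hm')
        · exact hp.delivered _ _ _ hm'
      · exact hp
    simp only [effect]
    rcases m.cert with _ | c
    · exact hd
    · exact hd.congr rfl rfl rfl rfl rfl
  | _ => exact hp.congr rfl rfl rfl rfl rfl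

/-- The state after the action is needed for `send`, which appends the message to `own` in the same
step. Forwarded messages and replies are copies from `store` or `own`, so they were genuine before.
-/
theorem Inv.genuine_of_output {Byz : Finset (Fin n)} {s : Config n V D} (h : Pr.Inv Byz s)
    {p : Fin n} {a : Act n V D} (hg : Pr.Guard p (s.loc p) a) {x : Packet n V D}
    (hx : x ∈ Pr.output p (s.loc p) a) {m : Msg n V D} (hm : m ∈ x.payload.msgs) :
    Genuine Byz (Pr.perform s p a) m := by
  cases a with
  | send cert prev =>
    obtain ⟨q, -, rfl⟩ := hx
    obtain rfl : m = _ := hm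
    intro _
    change _ ∈ ((Pr.perform s p _).loc p).own
    rw [perform_loc_self]
    simp [effect]
  | answer dst b m' c =>
    obtain rfl : x = _ := hx
    obtain rfl : m = m' := hm
    refine Genuine.mono ?_ (Pr.le_perform _ _ _)
    obtain ⟨-, ⟨rfl, h1⟩ | h1, -⟩ := hg
    · exact fun _ => h1
    · exact ((h.loc p).store _ _ _ h1).2.2
  | sign m' =>
    refine Genuine.mono ?_ (Pr.le_perform _ _ _)
    rcases hx with ⟨q, -, rfl⟩ | ⟨q, rfl⟩
    · obtain rfl : m = m' := hm
      exact ((h.loc p).store _ _ _ hg.1).2.2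
    · exact hm.elim
  | fetch => obtain ⟨q, -, rfl⟩ := hx; exact hm.elim
  | walkRequest => obtain ⟨q, -, rfl⟩ := hx; exact hm.elim
  | collect => obtain ⟨j, q, -, rfl⟩ := hx; exact hm.elim
  | _ => exact hx.elim

theorem Inv.step {Byz : Finset (Fin n)} {s s' : Config n V D} (h : Pr.Inv Byz s)
    (hs : Pr.Step Byz s s') : Pr.Inv Byz s' := by
  have hle := hs.le
  cases hs with
  | idle => exact h
  | honest p a hp ha =>
    refine ⟨fun q => ?_, ?_, fun q m hm q' hq' => ?_⟩
    · rcases eq_or_ne q p with rfl | hq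
      · rw [perform_loc_self]
        exact (h.localInv_effect ha).mono hle
      · have : (Pr.perform s p a).loc q = s.loc q := by simp [perform, hq]
        rw [this]
        exact (h.loc q).mono hle
    · rintro x (hx | hx) m hm
      · exact (h.net x hx m hm).mono hle
      · exact h.genuine_of_output ha.1 hx hm
    -- Only `send` creates an own message, and it emits the packets to the committee in the same
    -- step.
    · by_cases hm0 : m ∈ (s.loc q).own
      · exact hle.1 (h.sent q m hm0 q' hq')
      · rcases eq_or_ne q p with rfl | hq
        · rw [perform_loc_self] at hm
          right
          cases a with
          | send cert prev =>
            simp only [effect, List.mem_append, hm0, List.mem_singleton, false_or] at hm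
            subst hm
            exact ⟨q', hq', rfl⟩
          | certify c => 
            simp only [effect] at hm
            rw [(Pr.processCertificate_messages _ _ _ _).2.1] at hm
            exact absurd hm hm0
          | walkStep w m' =>
            refine absurd ?_ hm0
            simp only [effect] at hm
            have he : (if w.round ≤ w.top then Pr.deliver w.sender w.round m' (s.loc q)
                else s.loc q).own = (s.loc q).own := by
              split_ifs
              · exact (Pr.deliver_messages _ _ _ _).2.2.1
              · rfl
            rw [← he]
            generalize m'.cert = o at hm
            rcases o with _ | c <;> exact hm
          | _ => exact absurd hm hm0
        · exact absurd (by simpa [perform, hq] using hm) hm0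
  | byzantine p q π hp hπ =>
    refine ⟨fun q => (h.loc q).mono hle, ?_, fun q m hm q' hq' => hle.1 (h.sent q m hm q' hq')⟩
    rintro x (rfl | hx) m hm
    -- The idealized signatures enter here: a message of an honest sender that the adversary injects
    -- was created by that sender.
    · exact fun hb => hπ.1 m hm hb
    · exact (h.net x hx m hm).mono hle

theorem IsExecution.inv {Byz : Finset (Fin n)} {σ : ℕ → Config n V D}
    (h : Pr.IsExecution Byz σ) (t : ℕ) : Pr.Inv Byz (σ t) := by
  induction t with
  | zero =>
    rw [h.start]
    exact ⟨fun p => ⟨fun k m hm => by simp [Config.start, Local.start] at hm, by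
      simp [Config.start, Local.start], by simp [Config.start, Local.start], by
      simp [Config.start, Local.start], by simp [Config.start, Local.start]⟩,
      by simp [Config.start], by simp [Config.start, Local.start]⟩
  | succ t ih => exact ih.step (h.step t)

end Protocol

end APMBRB
-- Liveness
namespace APMBRB
namespace Protocol

open Filter

variable {n : ℕ} {V D : Type*} {Pr : Protocol n V D} {Byz : Finset (Fin n)}
  {σ : ℕ → Config n V D}

theorem Holds.mono {ℓ ℓ' : Local n V D} {c : Cert n D} (h : Pr.Holds ℓ c) (hle : ℓ ≤ ℓ') :
    Pr.Holds ℓ' c := by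
  refine ⟨h.1, h.2.imp (fun h' s hs => ?_) ?_⟩
  · obtain ⟨src, hsrc⟩ := h' s hs
    exact ⟨src, hle.inbox hsrc⟩
  · rintro ⟨m, hm⟩
    exact ⟨m, hle.inbox hm⟩

/-! ### Fairness -/

/-- For persistent facts, holding once and holding from some time on coincide; the second form can
be combined by `filter_upwards`. -/
theorem IsExecution.eventually_of_exists (hσ : Pr.IsExecution Byz σ) {Q : Config n V D → Prop}
    (hQ : Monotone Q) (h : ∃ t, Q (σ t)) : ∀ᶠ t in atTop, Q (σ t) := by
  obtain ⟨t, ht⟩ := h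
  exact eventually_atTop.2 ⟨t, fun t' h' => hQ (hσ.monotone h') ht⟩

/-- Meant for goals that disable the action leading to them, such as the growth of a list. If the
goal is never reached, the list eventually has constant length, the action stays enabled, and
fairness applies. -/
theorem IsExecution.eventually_or_never (hσ : Pr.IsExecution Byz σ) {Q : Config n V D → Prop}
    (hQ : Monotone Q) : (∀ᶠ t in atTop, Q (σ t)) ∨ ∀ t, ¬ Q (σ t) := by
  by_cases h : ∃ t, Q (σ t)
  · exact .inl (hσ.eventually_of_exists hQ h)
  · exact .inr (not_exists.1 h)

/-- Fairness performs `a` at some late time, and `Q` persists from then on. Since `hperf` is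
required only eventually, it may use facts that become true late. -/
theorem IsExecution.eventually_of_fair (hσ : Pr.IsExecution Byz σ) {Q : Config n V D → Prop}
    (hQ : Monotone Q) {p : Fin n} (hp : p ∉ Byz) {a : Act n V D}
    (ha : ∀ᶠ t in atTop, Pr.Enabled (σ t) p a)
    (hperf : ∀ᶠ t in atTop, Pr.Enabled (σ t) p a → Q (Pr.perform (σ t) p a)) :
    ∀ᶠ t in atTop, Q (σ t) := by
  obtain ⟨T, hT⟩ := eventually_atTop.1 (ha.and hperf)
  obtain ⟨t, ht, e⟩ := hσ.fair p hp a T fun t' h' => (hT t' h').1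
  exact hσ.eventually_of_exists hQ ⟨t + 1, e ▸ (hT t ht).2 (hT t ht).1⟩

theorem IsExecution.eventually_received (hσ : Pr.IsExecution Byz σ) {p src : Fin n} (hp : p ∉ Byz)
    {π : Payload n V D} (h : ∀ᶠ t in atTop, (⟨src, p, π⟩ : Packet n V D) ∈ (σ t).net) :
    ∀ᶠ t in atTop, (src, π) ∈ ((σ t).loc p).inbox := by
  refine hσ.eventually_of_fair (Q := fun s => (src, π) ∈ (s.loc p).inbox)
    (fun s s' hs h' => (hs.2 p).inbox h') hp (a := .recv src π) ?_ (.of_forall fun t _ => ?_)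
  · filter_upwards [h] with t ht
    refine ⟨trivial, ?_⟩
    rintro _ _ ⟨⟩
    exact ht
  · rw [perform_loc_self]
    simp [effect]

/-! ### Messages of honest senders -/

/-- At some time `m` is the message with index `k`, hence of round `k + 1`, that `i` has created. -/
def Broadcasts (σ : ℕ → Config n V D) (i : Fin n) (k : ℕ) (m : Msg n V D) : Prop :=
  ∃ t, ((σ t).loc i).own[k]? = some m

theorem IsExecution.eventually_own (hσ : Pr.IsExecution Byz σ) {i : Fin n} {k : ℕ} {m : Msg n V D}
    (hm : Broadcasts σ i k m) : ∀ᶠ t in atTop, ((σ t).loc i).own[k]? = some m :=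
  hσ.eventually_of_exists (Q := fun s => (s.loc i).own[k]? = some m)
    (fun _ _ hs h => List.IsPrefix.getElem?_eq_some (hs.2 i).own h) hm

theorem IsExecution.broadcasts_unique (hσ : Pr.IsExecution Byz σ) {i : Fin n} {k : ℕ}
    {m m' : Msg n V D} (hm : Broadcasts σ i k m) (hm' : Broadcasts σ i k m') : m = m' := by
  obtain ⟨t, h1, h2⟩ := ((hσ.eventually_own hm).and (hσ.eventually_own hm')).exists
  exact Option.some.inj (h1.symm.trans h2)

theorem IsExecution.broadcasts_sender_round (hσ : Pr.IsExecution Byz σ) {i : Fin n} {k : ℕ}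
    {m : Msg n V D} (hm : Broadcasts σ i k m) :
    m.sender = i ∧ m.round = k + 1 ∧ m.content = Pr.input i (k + 1) := by
  obtain ⟨t, h⟩ := hm
  obtain ⟨h1, h2, h3, -⟩ := ((hσ.inv t).loc i).own k m h
  exact ⟨h1, h2, h3⟩

theorem IsExecution.exists_cert (hσ : Pr.IsExecution Byz σ) {i : Fin n} {k : ℕ}
    {m m' : Msg n V D} (hm : Broadcasts σ i (k + 1) m) (hm' : Broadcasts σ i k m') :
    ∃ c, m.cert = some c ∧ Pr.Certifies c m' := by
  obtain ⟨t, h⟩ := hm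
  obtain ⟨-, -, -, h4⟩ := ((hσ.inv t).loc i).own _ m h
  obtain ⟨c, m'', e1, e2, e3⟩ := h4 k rfl
  obtain rfl := hσ.broadcasts_unique hm' ⟨t, e2⟩
  exact ⟨c, e1, e3⟩

theorem IsExecution.broadcasts_of_genuine (hσ : Pr.IsExecution Byz σ) {t : ℕ} {i : Fin n} {k : ℕ}
    (hi : i ∉ Byz) {m : Msg n V D} (hs : m.sender = i) (hr : m.round = k + 1)
    (hg : Genuine Byz (σ t) m) : Broadcasts σ i k m := by
  subst hs
  obtain ⟨k', hk'⟩ := List.mem_iff_getElem?.1 (hg hi)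
  have := (((hσ.inv t).loc m.sender).own k' m hk').2.1
  obtain rfl : k' = k := by omega
  exact ⟨t, hk'⟩

/-- Honest senders do not equivocate: a genuine message lies in the own list, where the round
determines the index. Hence it suffices to show that a slot gets filled, without tracking by what.
-/
theorem IsExecution.eq_of_genuine (hσ : Pr.IsExecution Byz σ) {t : ℕ} {i : Fin n} {k : ℕ}
    (hi : i ∉ Byz) {m m' : Msg n V D} (hm : Broadcasts σ i k m)
    (h : m'.sender = i ∧ m'.round = k + 1 ∧ Genuine Byz (σ t) m') : m' = m :=
  hσ.broadcasts_unique (hσ.broadcasts_of_genuine hi h.1 h.2.1 h.2.2) hm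

theorem IsExecution.eventually_stored (hσ : Pr.IsExecution Byz σ) {i q : Fin n} {k : ℕ}
    (hi : i ∉ Byz) (hq : q ∉ Byz) (hqC : q ∈ Pr.sampleCommittee i (k + 1)) {m : Msg n V D}
    (hm : Broadcasts σ i k m) :
    ∀ᶠ t in atTop, ((σ t).loc q).store i (k + 1) = some m := by
  obtain ⟨hs, hr, -⟩ := hσ.broadcasts_sender_round hm
  have hnet : ∀ᶠ t in atTop, (⟨i, q, .msg m⟩ : Packet n V D) ∈ (σ t).net := by
    filter_upwards [hσ.eventually_own hm] with t ht
    exact (hσ.inv t).sent i m (List.mem_of_getElem? ht) q (hr ▸ hqC)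
  -- Receiving `m` fills the slot unless it is already occupied; the occupant is then identified by
  -- genuineness.
  have hst : ∀ᶠ t in atTop, ∃ m', ((σ t).loc q).store i (k + 1) = some m' := by
    refine hσ.eventually_of_fair (Q := fun s => ∃ m', (s.loc q).store i (k + 1) = some m')
      (fun s s' hs ⟨m', h'⟩ => ⟨m', (hs.2 q).store _ _ _ h'⟩) hq (a := .recv i (.msg m)) ?_
      (.of_forall fun t _ => ?_)
    · filter_upwards [hnet] with t ht
      refine ⟨trivial, ?_⟩
      rintro _ _ ⟨⟩
      exact ht
    · rw [perform_loc_self]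
      simp only [effect, hs, hr]
      split_ifs with hc
      · exact ⟨m, by simp⟩
      · exact Option.ne_none_iff_exists'.1 fun h => hc ⟨by omega, hqC, h⟩
  filter_upwards [hst] with t ⟨m', h'⟩
  rw [h', hσ.eq_of_genuine hi hm (((hσ.inv t).loc q).store _ _ _ h')]

theorem IsExecution.eventually_answered (hσ : Pr.IsExecution Byz σ) {p q : Fin n} (hp : p ∉ Byz)
    (hq : q ∉ Byz) {m : Msg n V D} {b : Bool}
    (hreq : ∀ᶠ t in atTop,
      (⟨p, q, .request m.sender m.round b⟩ : Packet n V D) ∈ (σ t).net)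
    (hm : ∀ᶠ t in atTop, (q = m.sender ∧ m ∈ ((σ t).loc q).own) ∨
      ((σ t).loc q).store m.sender m.round = some m)
    (hc : b = true → ∃ c, Pr.Certifies c m ∧ ∀ᶠ t in atTop, Pr.Holds ((σ t).loc q) c) :
    ∃ c, ∀ᶠ t in atTop, (q, Payload.reply m c) ∈ ((σ t).loc p).inbox := by
  -- Fairness concerns one fixed action, so the certificate in the reply has to be chosen
  -- independently of time.
  obtain ⟨c, hc1, hc2⟩ : ∃ c : Option (Cert n D), (b = true → ∀ᶠ t in atTop,
      ∃ c', c = some c' ∧ Pr.Holds ((σ t).loc q) c' ∧ Pr.Certifies c' m) ∧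
      (b = false → c = none) := by
    cases b with
    | false => exact ⟨none, by simp, by simp⟩
    | true =>
      obtain ⟨c, h1, h2⟩ := hc rfl
      refine ⟨some c, fun _ => ?_, by simp⟩
      filter_upwards [h2] with t ht using ⟨c, rfl, ht, h1⟩
  refine ⟨c, hσ.eventually_received hp ?_⟩
  refine hσ.eventually_of_fair
    (Q := fun s => (⟨q, p, .reply m c⟩ : Packet n V D) ∈ s.net)
    (fun s s' hs h' => hs.1 h') hq (a := .answer p b m c) ?_
    (.of_forall fun t _ => .inr rfl)
  filter_upwards [hσ.eventually_received hq hreq, hm, eventually_imp_distrib_left.2 hc1]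
    with t h1 h2 h3
  refine ⟨⟨h1, h2, h3, hc2⟩, ?_⟩
  rintro _ _ ⟨⟩

/-! ### Fetching, signing and certificates -/

/-- There is a certificate for `m` which every honest node eventually obtains. -/
def EventuallyCertified (Pr : Protocol n V D) (Byz : Finset (Fin n)) (σ : ℕ → Config n V D)
    (m : Msg n V D) : Prop :=
  ∃ c, Pr.Certifies c m ∧ ∀ p, p ∉ Byz → ∀ᶠ t in atTop, Pr.Holds ((σ t).loc p) c

theorem exists_honest_mem (hmaj : ∀ i r, Pr.nc < 2 * (Pr.sampleCommittee i r \ Byz).card)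
    (i : Fin n) (r : ℕ) : ∃ q ∈ Pr.sampleCommittee i r, q ∉ Byz := by
  have : 0 < (Pr.sampleCommittee i r \ Byz).card := by have := hmaj i r; omega
  obtain ⟨q, hq⟩ := Finset.card_pos.1 this
  exact ⟨q, (Finset.mem_sdiff.1 hq).1, (Finset.mem_sdiff.1 hq).2⟩

/-- One honest node among those asked has `m` and answers: the sender itself for `reqMsg`, an honest
committee member for `syncMsg`. -/
theorem IsExecution.eventually_obtained (hσ : Pr.IsExecution Byz σ)
    (hmaj : ∀ i r, Pr.nc < 2 * (Pr.sampleCommittee i r \ Byz).card) {i p : Fin n} {k : ℕ}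
    (hi : i ∉ Byz) (hp : p ∉ Byz) {m : Msg n V D} (hm : Broadcasts σ i k m) {b b' : Bool}
    (hreq : ∀ᶠ t in atTop, ∀ q ∈ Pr.fetchFrom i (k + 1) b,
      (⟨p, q, .request i (k + 1) b'⟩ : Packet n V D) ∈ (σ t).net)
    (hc : b' = true → Pr.EventuallyCertified Byz σ m) :
    ∀ᶠ t in atTop, ((σ t).loc p).Obtained (Pr.fetchFrom i (k + 1) b) m := by
  obtain ⟨hs, hr, -⟩ := hσ.broadcasts_sender_round hm
  obtain ⟨q, hqC, hq, hst⟩ : ∃ q ∈ Pr.fetchFrom i (k + 1) b, q ∉ Byz ∧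
      ∀ᶠ t in atTop, (q = m.sender ∧ m ∈ ((σ t).loc q).own) ∨
        ((σ t).loc q).store m.sender m.round = some m := by
    cases b with
    | false =>
      refine ⟨i, by simp [fetchFrom], hi, ?_⟩
      filter_upwards [hσ.eventually_own hm] with t ht
        using .inl ⟨hs.symm, List.mem_of_getElem? ht⟩
    | true =>
      obtain ⟨q, hqC, hq⟩ := exists_honest_mem hmaj i (k + 1)
      refine ⟨q, by simpa [fetchFrom] using hqC, hq, ?_⟩
      filter_upwards [hσ.eventually_stored hi hq hqC hm] with t ht
      rw [hs, hr]
      exact .inr ht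
  obtain ⟨c, h⟩ := hσ.eventually_answered (m := m) (b := b') hp hq
    (by filter_upwards [hreq] with t ht; rw [hs, hr]; exact ht q hqC) hst
    (fun hb => by obtain ⟨c, h1, h2⟩ := hc hb; exact ⟨c, h1, h2 q hq⟩)
  filter_upwards [h] with t ht using ⟨q, hqC, c, ht⟩

/-- A list stuck at length `y` keeps its request enabled; an honest reply then makes `promise`
enabled for good, and performing it makes the list longer. Certificates are assumed only in mode
`reqMsg` and only for the last round, where the guard asks for one. -/
theorem IsExecution.eventually_le_length_promises (hσ : Pr.IsExecution Byz σ)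
    (hmaj : ∀ i r, Pr.nc < 2 * (Pr.sampleCommittee i r \ Byz).card) {i p : Fin n} {r : ℕ}
    (hi : i ∉ Byz) (hp : p ∉ Byz) {b : Bool}
    (hcall : ∀ᶠ t in atTop, (i, r, b) ∈ ((σ t).loc p).calls)
    (hB : ∀ k < r, ∃ m, Broadcasts σ i k m)
    (hc : b = false → ∀ k m, k + 1 = r → Broadcasts σ i k m → Pr.EventuallyCertified Byz σ m)
    {y : ℕ} (hy : y ≤ r) : ∀ᶠ t in atTop, y ≤ (((σ t).loc p).promises i).length := by
  induction y with
  | zero => simp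
  | succ y ih =>
    have hmono : Monotone fun s : Config n V D => y + 1 ≤ ((s.loc p).promises i).length :=
      fun s s' hs h' => h'.trans ((hs.2 p).promises i).length_le
    refine (hσ.eventually_or_never hmono).elim id fun hnever => ?_
    have hlen : ∀ᶠ t in atTop, (((σ t).loc p).promises i).length = y := by
      filter_upwards [ih (by omega)] with t ht
      have := hnever t
      omega
    obtain ⟨m, hm⟩ := hB y hy
    obtain ⟨hs, hr, -⟩ := hσ.broadcasts_sender_round hm
    have hreq : ∀ᶠ t in atTop, ∀ q ∈ Pr.fetchFrom i (y + 1) b,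
        (⟨p, q, .request i (y + 1) (!b && decide (y + 1 = r) && decide (r ≠ 1))⟩ :
          Packet n V D) ∈ (σ t).net := by
      refine hσ.eventually_of_fair (Q := fun s => ∀ q ∈ Pr.fetchFrom i (y + 1) b,
        (⟨p, q, .request i (y + 1) (!b && decide (y + 1 = r) && decide (r ≠ 1))⟩ :
          Packet n V D) ∈ s.net) (fun s s' hs h' q hq => hs.1 (h' q hq)) hp
        (a := .fetch i r b) ?_ ?_
      · filter_upwards [hcall, hlen] with t h1 h2
        refine ⟨⟨h1, by omega⟩, ?_⟩
        rintro _ _ ⟨⟩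
      · filter_upwards [hlen] with t h2 _ q hq
        exact .inr ⟨q, by rwa [h2], by rw [h2]⟩
    have hobt := hσ.eventually_obtained hmaj hi hp hm hreq fun hb => by
      simp only [Bool.and_eq_true, Bool.not_eq_true', decide_eq_true_eq] at hb
      exact hc hb.1.1 y m hb.1.2 hm
    have hcert : ∀ᶠ t in atTop, m.round = r ∧ b = false →
        ∃ c, Pr.Holds ((σ t).loc p) c ∧ Pr.Certifies c m := by
      refine eventually_imp_distrib_left.2 fun ⟨h1, h2⟩ => ?_
      obtain ⟨c, e1, e2⟩ := hc h2 y m (by omega) hm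
      filter_upwards [e2 p hp] with t ht using ⟨c, ht, e1⟩
    refine hσ.eventually_of_fair hmono hp (a := .promise i r b m) ?_ ?_
    · filter_upwards [hcall, hlen, hobt, hcert] with t h1 h2 h3 h4
      refine ⟨⟨h1, by omega, hs, by omega, hr ▸ h3, fun m' hm' => ?_, h4⟩, ?_⟩
      -- The last promise is genuine, hence the sender's own predecessor of `m`, which the
      -- certificate inside `m` certifies.
      · rw [Option.mem_def, List.getLast?_eq_getElem?, h2] at hm'
        have hy0 : y ≠ 0 := by
          rintro rfl
          simp [List.length_eq_zero_iff.1 h2] at hm'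
        obtain ⟨y, rfl⟩ := Nat.exists_eq_succ_of_ne_zero hy0
        obtain ⟨e1, e2, e3⟩ := ((hσ.inv t).loc p).promises _ _ _ hm'
        exact hσ.exists_cert hm (hσ.broadcasts_of_genuine hi e1 e2 e3)
      · rintro _ _ ⟨⟩
    · filter_upwards [hlen] with t h2 _
      rw [perform_loc_self]
      simp [effect, h2]

theorem IsExecution.eventually_promised (hσ : Pr.IsExecution Byz σ)
    (hmaj : ∀ i r, Pr.nc < 2 * (Pr.sampleCommittee i r \ Byz).card) {i p : Fin n} {r : ℕ}
    (hi : i ∉ Byz) (hp : p ∉ Byz) {b : Bool}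
    (hcall : ∀ᶠ t in atTop, (i, r, b) ∈ ((σ t).loc p).calls)
    (hB : ∀ k < r, ∃ m, Broadcasts σ i k m)
    (hc : b = false → ∀ k m, k + 1 = r → Broadcasts σ i k m → Pr.EventuallyCertified Byz σ m)
    {k : ℕ} (hk : k < r) {m : Msg n V D} (hm : Broadcasts σ i k m) :
    ∀ᶠ t in atTop, (((σ t).loc p).promises i)[k]? = some m := by
  filter_upwards [hσ.eventually_le_length_promises hmaj hi hp hcall hB hc (y := k + 1) hk]
    with t ht
  have h := List.getElem?_eq_getElem (l := ((σ t).loc p).promises i) (i := k) (by omega)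
  rw [h, hσ.eq_of_genuine hi hm (((hσ.inv t).loc p).promises _ _ _ h)]

theorem IsExecution.eventually_shared (hσ : Pr.IsExecution Byz σ)
    (hmaj : ∀ i r, Pr.nc < 2 * (Pr.sampleCommittee i r \ Byz).card) {i q : Fin n} {k : ℕ}
    (hi : i ∉ Byz) (hq : q ∉ Byz) (hqC : q ∈ Pr.sampleCommittee i (k + 1))
    (hB : ∀ k' < k, ∃ m, Broadcasts σ i k' m) {m : Msg n V D} (hm : Broadcasts σ i k m) :
    ∀ᶠ t in atTop, ∀ p, (⟨q, p, .share (Pr.tag m) q⟩ : Packet n V D) ∈ (σ t).net := by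
  obtain ⟨hs, hr, -⟩ := hσ.broadcasts_sender_round hm
  have hst := hσ.eventually_stored hi hq hqC hm
  have hok : ∀ᶠ t in atTop, m.round = 1 ∨ (2 ≤ m.round ∧
      (m.sender, m.round - 1, true) ∈ ((σ t).loc q).calls ∧
      ∃ c m', m.cert = some c ∧ (((σ t).loc q).promises m.sender)[m.round - 2]? = some m' ∧
        Pr.Certifies c m') := by
    rw [hs, hr]
    rcases k with _ | k
    · simp
    · have hcall : ∀ᶠ t in atTop, (i, k + 1, true) ∈ ((σ t).loc q).calls := by
        refine hσ.eventually_of_fair (Q := fun s => (i, k + 1, true) ∈ (s.loc q).calls)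
          (fun s s' hs h' => (hs.2 q).calls h') hq (a := .sync i (k + 1 + 1)) ?_
          (.of_forall fun t _ => ?_)
        · filter_upwards [hst] with t ht
          refine ⟨⟨by omega, m, ht⟩, ?_⟩
          rintro _ _ ⟨⟩
        · rw [perform_loc_self]
          simp [effect]
      obtain ⟨m', hm'⟩ := hB k (by omega)
      obtain ⟨c, hc1, hc2⟩ := hσ.exists_cert hm hm'
      filter_upwards [hcall, hσ.eventually_promised hmaj hi hq hcall hB (by simp)
        (Nat.lt_succ_self k) hm'] with t h1 h2
      exact .inr ⟨by omega, h1, c, m', hc1, h2, hc2⟩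
  refine hσ.eventually_of_fair
    (Q := fun s => ∀ p, (⟨q, p, .share (Pr.tag m) q⟩ : Packet n V D) ∈ s.net)
    (fun s s' hs h' p => hs.1 (h' p)) hq (a := .sign m) ?_
    (.of_forall fun t _ p => .inr (.inr ⟨p, rfl⟩))
  filter_upwards [hst, hok] with t h1 h2
  refine ⟨⟨by rw [hs, hr]; exact h1, h2⟩, ?_⟩
  rintro _ _ ⟨⟩

/-- Merge the shares of exactly the honest committee members. All of them sign, and being more than
`nc / 2` they reach the threshold without Byzantine help. -/
theorem IsExecution.eventuallyCertified (hσ : Pr.IsExecution Byz σ)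
    (hmaj : ∀ i r, Pr.nc < 2 * (Pr.sampleCommittee i r \ Byz).card) {i : Fin n} {k : ℕ}
    (hi : i ∉ Byz) (hB : ∀ k' < k, ∃ m, Broadcasts σ i k' m) {m : Msg n V D}
    (hm : Broadcasts σ i k m) : Pr.EventuallyCertified Byz σ m := by
  obtain ⟨hs, hr, -⟩ := hσ.broadcasts_sender_round hm
  have hvalid : Pr.Valid ⟨Pr.tag m, Pr.sampleCommittee i (k + 1) \ Byz⟩ := by
    refine ⟨by simp [tag, hs, hr], ?_⟩
    have := hmaj i (k + 1)
    change Pr.nc / 2 + 1 ≤ (Pr.sampleCommittee i (k + 1) \ Byz).card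
    omega
  refine ⟨⟨Pr.tag m, Pr.sampleCommittee i (k + 1) \ Byz⟩, ⟨hvalid, rfl⟩, fun p hp => ?_⟩
  have h : ∀ᶠ t in atTop, ∀ q ∈ Pr.sampleCommittee i (k + 1) \ Byz,
      (q, Payload.share (Pr.tag m) q) ∈ ((σ t).loc p).inbox := by
    refine (Finset.eventually_all _).2 fun q hq => hσ.eventually_received hp ?_
    obtain ⟨hqC, hq⟩ := Finset.mem_sdiff.1 hq
    filter_upwards [hσ.eventually_shared hmaj hi hq hqC hB hm] with t ht using ht p
  filter_upwards [h] with t ht using ⟨hvalid, .inl fun q hq => ⟨q, ht q hq⟩⟩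

/-! ### Progress of the rounds -/

theorem length_own_perform_send (s : Config n V D) (p : Fin n) (cert : Option (Cert n D))
    (prev : Fin n → Option (Cert n D)) :
    ((Pr.perform s p (.send cert prev)).loc p).own.length = (s.loc p).own.length + 1 := by
  rw [perform_loc_self]
  simp [effect]

theorem IsExecution.eventually_reqDone (hσ : Pr.IsExecution Byz σ)
    (hmaj : ∀ i r, Pr.nc < 2 * (Pr.sampleCommittee i r \ Byz).card) {i j : Fin n} {k : ℕ}
    (hi : i ∉ Byz) (hj : j ∉ Byz) (hB : ∀ k' ≤ k, ∃ m, Broadcasts σ j k' m)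
    (hcall : ∀ᶠ t in atTop, (j, k + 1, false) ∈ ((σ t).loc i).calls) :
    ∃ c, ∀ᶠ t in atTop, Pr.ReqDone ((σ t).loc i) j (k + 1) c := by
  obtain ⟨m, hm⟩ := hB k le_rfl
  have hC : ∀ k' m', k' + 1 = k + 1 → Broadcasts σ j k' m' →
      Pr.EventuallyCertified Byz σ m' := fun k' m' hk' hm' =>
    hσ.eventuallyCertified hmaj hj (fun k'' hk'' => hB k'' (by omega)) hm'
  obtain ⟨c, hc1, hc2⟩ := hC k m rfl hm
  refine ⟨c, ?_⟩
  filter_upwards [hcall, hc2 i hi, hσ.eventually_promised hmaj hj hi hcall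
    (fun k' hk' => hB k' (by omega)) (fun _ => hC) (Nat.lt_succ_self k) hm] with t h1 h2 h3
  exact ⟨h1, h2, m, h3, hc1⟩

/-- A node stuck after `r` messages would have one fixed `send` action enabled forever. In later
rounds, its `prev` is filled from `2f+1` honest nodes, whose requests all complete. -/
theorem IsExecution.eventually_lt_length_own (hσ : Pr.IsExecution Byz σ)
    (hmaj : ∀ i r, Pr.nc < 2 * (Pr.sampleCommittee i r \ Byz).card)
    (hf : 2 * Pr.f + 1 ≤ (Finset.univ \ Byz).card) (r : ℕ)
    (hB : ∀ j, j ∉ Byz → ∀ k < r, ∃ m, Broadcasts σ j k m) {i : Fin n} (hi : i ∉ Byz) :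
    ∀ᶠ t in atTop, r < ((σ t).loc i).own.length := by
  classical
  have hmono : Monotone fun s : Config n V D => r < (s.loc i).own.length :=
    fun s s' hs h' => lt_of_lt_of_le h' (hs.2 i).own.length_le
  refine (hσ.eventually_or_never hmono).elim id fun hnever => ?_
  have hlen : ∀ᶠ t in atTop, ((σ t).loc i).own.length = r := by
    rcases r with _ | r
    · exact .of_forall fun t => by have := hnever t; omega
    · obtain ⟨m, hm⟩ := hB i hi r (by omega)
      filter_upwards [hσ.eventually_own hm] with t ht
      have := hnever t
      have := (List.getElem?_eq_some_iff.1 ht).1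
      omega
  suffices h : ∃ cert prev, ∀ᶠ t in atTop, Pr.Guard i ((σ t).loc i) (.send cert prev) by
    obtain ⟨cert, prev, h⟩ := h
    refine hσ.eventually_of_fair hmono hi (a := .send cert prev) ?_ ?_
    · filter_upwards [h] with t ht
      refine ⟨ht, ?_⟩
      rintro _ _ ⟨⟩
    · filter_upwards [hlen] with t ht _
      rw [length_own_perform_send]
      omega
  rcases r with _ | r
  · refine ⟨none, fun _ => none, ?_⟩
    filter_upwards [hlen] with t ht
    exact .inl ⟨List.length_eq_zero_iff.1 ht, rfl, rfl⟩
  · have hcall : ∀ᶠ t in atTop, ∀ j, (j, r + 1, false) ∈ ((σ t).loc i).calls := by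
      refine hσ.eventually_of_fair (Q := fun s => ∀ j, (j, r + 1, false) ∈ (s.loc i).calls)
        (fun s s' hs h' j => (hs.2 i).calls (h' j)) hi (a := .invoke) ?_ ?_
      · filter_upwards [hlen] with t ht
        refine ⟨fun h => by simp [h] at ht, ?_⟩
        rintro _ _ ⟨⟩
      · filter_upwards [hlen] with t ht _ j
        rw [perform_loc_self]
        exact .inr ⟨j, by rw [ht]⟩
    have hreq : ∀ j, ∃ c, j ∉ Byz →
        ∀ᶠ t in atTop, Pr.ReqDone ((σ t).loc i) j (r + 1) c := fun j => by
      by_cases hj : j ∈ Byz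
      -- Nothing is claimed for Byzantine `j`; any certificate will do as a value for the total
      -- function that `choose` produces.
      · obtain ⟨m, hm⟩ := hB i hi r (by omega)
        obtain ⟨c, -⟩ := hσ.eventuallyCertified hmaj hi (fun k hk => hB i hi k (by omega)) hm
        exact ⟨c, fun h => absurd hj h⟩
      · obtain ⟨c, hc⟩ := hσ.eventually_reqDone hmaj hi hj
          (k := r) (fun k hk => hB j hj k (by omega)) (by filter_upwards [hcall] with t ht using ht j)
        exact ⟨c, fun _ => hc⟩
    choose c hc using hreq
    obtain ⟨J, hJ, hJcard⟩ := Finset.exists_subset_card_eq hf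
    obtain ⟨m, hm⟩ := hB i hi r (by omega)
    obtain ⟨c₀, h1, h2⟩ := hσ.eventuallyCertified hmaj hi (fun k hk => hB i hi k (by omega)) hm
    refine ⟨some c₀, fun j => if j ∈ J then some (c j) else none, ?_⟩
    have hJc : ∀ᶠ t in atTop, ∀ j ∈ J, Pr.ReqDone ((σ t).loc i) j (r + 1) (c j) :=
      (Finset.eventually_all _).2 fun j hj => hc j (Finset.mem_sdiff.1 (hJ hj)).2
    filter_upwards [hlen, hσ.eventually_own hm, h2 i hi, hJc] with t e1 e2 e3 e4
    refine .inr ⟨m, c₀, ?_, rfl, e3, h1, J, hJcard, fun j hj => ⟨c j, by simp [hj], ?_⟩,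
      fun j hj => by simp [hj]⟩
    · rw [List.getLast?_eq_getElem?, e1]
      exact e2
    · rw [e1]
      exact e4 j hj

/-- A message waits for earlier rounds of other senders too, so the induction on the round keeps the
honest sender general. -/
theorem IsExecution.exists_broadcasts (hσ : Pr.IsExecution Byz σ)
    (hmaj : ∀ i r, Pr.nc < 2 * (Pr.sampleCommittee i r \ Byz).card)
    (hf : 2 * Pr.f + 1 ≤ (Finset.univ \ Byz).card) {i : Fin n} (hi : i ∉ Byz) (k : ℕ) :
    ∃ m, Broadcasts σ i k m := by
  induction k using Nat.strong_induction_on generalizing i with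
  | _ k ih =>
    obtain ⟨t, ht⟩ := (hσ.eventually_lt_length_own hmaj hf k
      (fun j hj k' hk' => ih k' hk' hj) hi).exists
    exact ⟨_, t, List.getElem?_eq_getElem ht⟩

/-! ### Delivery -/

theorem IsExecution.eventually_walk_obtained (hσ : Pr.IsExecution Byz σ)
    (hmaj : ∀ i r, Pr.nc < 2 * (Pr.sampleCommittee i r \ Byz).card) {i p : Fin n} {k top : ℕ}
    (hi : i ∉ Byz) (hp : p ∉ Byz) {m : Msg n V D} (hm : Broadcasts σ i k m) {c : Cert n D}
    (hw : ∀ᶠ t in atTop, ⟨i, k + 1, c, top⟩ ∈ ((σ t).loc p).walks) (hc : Pr.Certifies c m) :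
    ∀ᶠ t in atTop, Pr.Enabled (σ t) p (.walkStep ⟨i, k + 1, c, top⟩ m) := by
  obtain ⟨hs, hr, -⟩ := hσ.broadcasts_sender_round hm
  have hreq : ∀ᶠ t in atTop, ∀ q ∈ Pr.fetchFrom i (k + 1) true,
      (⟨p, q, .request i (k + 1) false⟩ : Packet n V D) ∈ (σ t).net := by
    refine hσ.eventually_of_fair (Q := fun s => ∀ q ∈ Pr.fetchFrom i (k + 1) true,
      (⟨p, q, .request i (k + 1) false⟩ : Packet n V D) ∈ s.net)
      (fun s s' hs h' q hq => hs.1 (h' q hq)) hp (a := .walkRequest ⟨i, k + 1, c, top⟩) ?_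
      (.of_forall fun t _ q hq => .inr ⟨q, by simpa [fetchFrom] using hq, rfl⟩)
    filter_upwards [hw] with t ht
    refine ⟨⟨ht, by simp⟩, ?_⟩
    rintro _ _ ⟨⟩
  filter_upwards [hw, hσ.eventually_obtained hmaj hi hp hm hreq (by simp)] with t h1 h2
  refine ⟨⟨h1, by simp, hs, hr, by simpa [fetchFrom] using h2, hc⟩, ?_⟩
  rintro _ _ ⟨⟩

theorem walk_mem_effect_walkStep (p : Fin n) (ℓ : Local n V D) (w : Walk n D) {m : Msg n V D}
    {c : Cert n D} (hc : m.cert = some c) :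
    ⟨w.sender, w.round - 1, c, w.top⟩ ∈ (Pr.effect p ℓ (.walkStep w m)).walks := by
  simp [effect, hc]

theorem delivered_effect_walkStep (p : Fin n) (ℓ : Local n V D) {w : Walk n D} (m : Msg n V D)
    (hw : w.round ≤ w.top) :
    ∃ m', (Pr.effect p ℓ (.walkStep w m)).delivered w.sender w.round = some m' := by
  have h : ∃ m', (Pr.deliver w.sender w.round m ℓ).delivered w.sender w.round = some m' := by
    rw [(Pr.deliver_messages _ _ _ _).2.2.2.2.2]
    split_ifs with h
    · exact ⟨m, by simp⟩
    · exact Option.ne_none_iff_exists'.1 h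
  simp only [effect, hw, if_true]
  generalize m.cert = o
  rcases o with _ | c <;> exact h

/-- Induction on the distance `d` to the target: each message obtained contains the certificate for
its predecessor, which continues the walk. Since `top` is the target round, the last step fills the
delivery slot. -/
theorem IsExecution.eventually_delivered_of_walk (hσ : Pr.IsExecution Byz σ)
    (hmaj : ∀ i r, Pr.nc < 2 * (Pr.sampleCommittee i r \ Byz).card) {i p : Fin n}
    (hi : i ∉ Byz) (hp : p ∉ Byz) (hB : ∀ k, ∃ m, Broadcasts σ i k m) {k : ℕ} {m : Msg n V D}
    (hm : Broadcasts σ i k m) (d : ℕ) {c : Cert n D} {m' : Msg n V D}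
    (hm' : Broadcasts σ i (k + d) m') (hc : Pr.Certifies c m')
    (hw : ∀ᶠ t in atTop, ⟨i, k + d + 1, c, k + 1⟩ ∈ ((σ t).loc p).walks) :
    ∀ᶠ t in atTop, ((σ t).loc p).delivered i (k + 1) = some m := by
  induction d generalizing c m' with
  | zero =>
    have hen := hσ.eventually_walk_obtained hmaj hi hp hm' hw hc
    have hdel : ∀ᶠ t in atTop, ∃ m'', ((σ t).loc p).delivered i (k + 1) = some m'' := by
      refine hσ.eventually_of_fair
        (Q := fun s => ∃ m'', (s.loc p).delivered i (k + 1) = some m'')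
        (fun s s' hs ⟨m'', h'⟩ => ⟨m'', (hs.2 p).delivered _ _ _ h'⟩) hp hen
        (.of_forall fun t _ => ?_)
      rw [perform_loc_self]
      exact delivered_effect_walkStep (w := ⟨i, k + 1, c, k + 1⟩) p _ m' le_rfl
    filter_upwards [hdel] with t ⟨m'', h'⟩
    rw [h', hσ.eq_of_genuine hi hm (((hσ.inv t).loc p).delivered _ _ _ h')]
  | succ d ih =>
    have hen := hσ.eventually_walk_obtained hmaj hi hp hm' hw hc
    obtain ⟨m'', hm''⟩ := hB (k + d)
    obtain ⟨c', e1, e2⟩ := hσ.exists_cert hm' hm''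
    refine ih hm'' e2 (hσ.eventually_of_fair
      (Q := fun s => ⟨i, k + d + 1, c', k + 1⟩ ∈ (s.loc p).walks)
      (fun s s' hs h' => (hs.2 p).walks h') hp hen (.of_forall fun t _ => ?_))
    rw [perform_loc_self]
    exact walk_mem_effect_walkStep p _ ⟨i, k + (d + 1) + 1, c, k + 1⟩ e1

/-- Every execution is valid if every committee has a majority of honest nodes. -/
theorem IsExecution.validity (hσ : Pr.IsExecution Byz σ)
    (hmaj : ∀ i r, Pr.nc < 2 * (Pr.sampleCommittee i r \ Byz).card)
    (hf : 2 * Pr.f + 1 ≤ (Finset.univ \ Byz).card) : Pr.Validity Byz σ := by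
  intro i hi r hr
  obtain ⟨k, rfl⟩ := Nat.exists_eq_add_of_le' hr
  have hB := hσ.exists_broadcasts hmaj hf hi
  obtain ⟨m, hm⟩ := hB k
  refine ⟨m, (hσ.broadcasts_sender_round hm).2.2, hm, fun p hp => ?_⟩
  -- Going `φ` rounds ahead makes the `top` of the resulting walk exactly the round `k + 1` to be
  -- delivered.
  obtain ⟨m', hm'⟩ := hB (k + Pr.φ)
  obtain ⟨hs', hr', -⟩ := hσ.broadcasts_sender_round hm'
  obtain ⟨c, hc1, hc2⟩ := hσ.eventuallyCertified hmaj hi (fun k' _ => hB k') hm'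
  refine (hσ.eventually_delivered_of_walk hmaj hi hp hB hm Pr.φ hm' hc1 ?_).exists
  refine hσ.eventually_of_fair
    (Q := fun s => ⟨i, k + Pr.φ + 1, c, k + 1⟩ ∈ (s.loc p).walks)
    (fun s s' hs h' => (hs.2 p).walks h') hp (a := .certify c) ?_ (.of_forall fun t _ => ?_)
  · filter_upwards [hc2 p hp] with t ht
    refine ⟨ht, ?_⟩
    rintro _ _ ⟨⟩
  · rw [perform_loc_self]
    have e1 : c.tag.sender = i := by rw [hc1.2]; exact hs'
    have e2 : c.tag.round = k + Pr.φ + 1 := by rw [hc1.2]; exact hr'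
    have e3 : k + Pr.φ + 1 - Pr.φ = k + 1 := by omega
    simp [effect, processCertificate, e1, e2, e3, show Pr.φ ≤ k + Pr.φ + 1 by omega]

end Protocol
end APMBRB
-- Hypergeometric tail and union bound over the committees
namespace APMBRB

open Finset

/-- For `t ≤ b`, the ratio of the binomials is the product of the factors `(b - s) / (n - s)` over
`s < t`, each at most `1 / 3`. -/
theorem choose_mul_three_pow_le {b n : ℕ} (h : 3 * b ≤ n) (t : ℕ) :
    b.choose t * 3 ^ t ≤ n.choose t := by
  induction t with
  | zero => simp
  | succ t ih =>
    refine Nat.le_of_mul_le_mul_right ?_ (Nat.succ_pos t)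
    rw [Nat.choose_succ_right_eq]
    calc b.choose (t + 1) * 3 ^ (t + 1) * (t + 1)
        = b.choose (t + 1) * (t + 1) * 3 ^ (t + 1) := by ring
      _ = b.choose t * 3 ^ t * (3 * (b - t)) := by rw [Nat.choose_succ_right_eq]; ring
      _ ≤ n.choose t * (n - t) := Nat.mul_le_mul ih (by omega)

/-- A bound for the moment generating function of the hypergeometric distribution. -/
theorem sum_two_pow_card_inter_le {n k : ℕ} (B : Finset (Fin n)) (hB : 3 * B.card ≤ n) :
    ∑ S ∈ powersetCard k univ, (2 : ℝ) ^ (S ∩ B).card ≤ n.choose k * (4 / 3) ^ k := by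
  have hT : ∀ T ∈ B.powerset,
      ((#{S ∈ powersetCard k (univ : Finset (Fin n)) | T ⊆ S} : ℕ) : ℝ) =
        n.choose k * k.choose #T / n.choose #T := by
    intro T _
    have hTn : #T ≤ n := by simpa using card_le_univ T
    have hpos : (0 : ℝ) < n.choose #T := by exact_mod_cast Nat.choose_pos hTn
    rw [eq_div_iff hpos.ne']
    norm_cast
    rcases le_or_gt (#T) k with h | h
    · rw [Nat.choose_mul h, mul_comm]
      congr 1
      rw [card_filter_powersetCard_subset _ _ _ (subset_univ T) h, card_univ, Fintype.card_fin]
    · rw [Nat.choose_eq_zero_of_lt h, mul_zero, filter_eq_empty_iff.2, card_empty, zero_mul]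
      intro S hS hTS
      have := card_le_card hTS
      have := (mem_powersetCard.1 hS).2
      omega
  -- The power of two counts the subsets `T` of `S ∩ B`. Exchanging sums leaves the number of `S`
  -- containing `T`, and the resulting sum is bounded by a binomial expansion of `(1/3 + 1) ^ k`.
  calc ∑ S ∈ powersetCard k univ, (2 : ℝ) ^ (S ∩ B).card
      = ∑ S ∈ powersetCard k univ, ∑ T ∈ B.powerset, if T ⊆ S then (1 : ℝ) else 0 := by
        refine sum_congr rfl fun S _ => ?_
        rw [sum_boole, ← Nat.cast_two, ← Nat.cast_pow, ← card_powerset]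
        congr 2
        ext T
        rw [mem_filter, mem_powerset, mem_powerset, subset_inter_iff, and_comm]
    _ = ∑ T ∈ B.powerset, (n.choose k * k.choose #T / n.choose #T : ℝ) := by
        rw [sum_comm]
        exact sum_congr rfl fun T hT' => by rw [sum_boole, hT T hT']
    _ = ∑ t ∈ range (#B + 1), (#B).choose t * (n.choose k * k.choose t / n.choose t : ℝ) := by
        rw [sum_powerset_apply_card (fun t => (n.choose k * k.choose t / n.choose t : ℝ))]
        simp
    _ ≤ ∑ t ∈ range (#B + 1), n.choose k * (k.choose t * (1 / 3) ^ t : ℝ) := by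
        refine sum_le_sum fun t ht => ?_
        have htn : t ≤ n := by have := mem_range.1 ht; omega
        have hpos : (0 : ℝ) < n.choose t := by exact_mod_cast Nat.choose_pos htn
        have h : ((#B).choose t : ℝ) * 3 ^ t ≤ n.choose t := by
          exact_mod_cast choose_mul_three_pow_le hB t
        have h' : ((#B).choose t : ℝ) / n.choose t ≤ (1 / 3) ^ t := by
          rw [div_le_iff₀ hpos, one_div, inv_pow, inv_mul_eq_div, le_div_iff₀ (by positivity)]
          exact h
        calc ((#B).choose t : ℝ) * (n.choose k * k.choose t / n.choose t)
            = n.choose k * (k.choose t * ((#B).choose t / n.choose t)) := by ring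
          _ ≤ _ := by gcongr
    -- Enlarging the range avoids comparing `#B` with `k`; the terms beyond `k` vanish.
    _ ≤ ∑ t ∈ range (#B + 1 + (k + 1)), n.choose k * (k.choose t * (1 / 3) ^ t : ℝ) :=
        sum_le_sum_of_subset_of_nonneg (range_mono (by omega)) fun _ _ _ => by positivity
    _ = ∑ t ∈ range (k + 1), n.choose k * (k.choose t * (1 / 3) ^ t : ℝ) := by
        refine (sum_subset (range_mono (by omega)) fun t _ ht => ?_).symm
        rw [Nat.choose_eq_zero_of_lt (n := k) (k := t) (by simpa using ht)]
        simp
    _ = n.choose k * (4 / 3) ^ k := by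
        rw [← mul_sum, show (4 / 3 : ℝ) = 1 / 3 + 1 by norm_num, add_pow]
        congr 1
        exact sum_congr rfl fun t _ => by simp [mul_comm]

/-- A Chernoff bound for the hypergeometric distribution. -/
theorem card_filter_le_two_mul_card_inter_le {n k : ℕ} (B : Finset (Fin n))
    (hB : 3 * B.card ≤ n) :
    (#{S ∈ powersetCard k (univ : Finset (Fin n)) | k ≤ 2 * #(S ∩ B)} : ℝ) ≤
      Real.exp (-(k / 18)) * n.choose k := by
  have h2 : (0 : ℝ) < √2 := by positivity
  have hsq : (√2 : ℝ) ^ 2 = 2 := Real.sq_sqrt (by norm_num)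
  -- Markov's inequality: on the bad sets the weight `2 ^ #(S ∩ B)` is at least `√2 ^ k`.
  have hmarkov : (#{S ∈ powersetCard k (univ : Finset (Fin n)) | k ≤ 2 * #(S ∩ B)} : ℝ) *
      √2 ^ k ≤ n.choose k * (4 / 3) ^ k := by
    refine le_trans ?_ (sum_two_pow_card_inter_le B hB)
    rw [← nsmul_eq_mul]
    refine (card_nsmul_le_sum _ (fun S => (2 : ℝ) ^ #(S ∩ B)) _ fun S hS => ?_).trans
      (sum_le_sum_of_subset_of_nonneg (filter_subset _ _) fun _ _ _ => by positivity)
    calc √2 ^ k ≤ √2 ^ (2 * #(S ∩ B)) :=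
          pow_le_pow_right₀ (Real.one_le_sqrt.2 (by norm_num)) (mem_filter.1 hS).2
      _ = 2 ^ #(S ∩ B) := by rw [pow_mul, hsq]
  -- The source of the constant 18: after squaring, the claim is `8 / 9 ≤ exp (-1/9)`, which is `1 +
  -- x ≤ exp x` at `x = -1/9`.
  have hbase : 4 / 3 ≤ Real.exp (-(1 / 18)) * √2 := by
    refine le_of_sq_le_sq ?_ (by positivity)
    rw [mul_pow, hsq, ← Real.exp_nat_mul]
    have := Real.add_one_le_exp ((2 : ℕ) * (-(1 / 18)) : ℝ)
    push_cast at this ⊢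
    linarith
  have hk : (4 / 3 : ℝ) ^ k ≤ Real.exp (-(k / 18)) * √2 ^ k := by
    calc (4 / 3 : ℝ) ^ k ≤ (Real.exp (-(1 / 18)) * √2) ^ k := by gcongr
      _ = _ := by
        rw [mul_pow, ← Real.exp_nat_mul]
        congr 2
        ring
  refine le_of_mul_le_mul_right ?_ (pow_pos h2 k)
  calc _ ≤ (n.choose k : ℝ) * (4 / 3) ^ k := hmarkov
    _ ≤ n.choose k * (Real.exp (-(k / 18)) * √2 ^ k) := by gcongr
    _ = _ := by ring

/-- One coordinate of a uniform function is uniform; the product form avoids division. -/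
theorem card_pi_apply_mul_card {ι X : Type*} [Fintype ι] [DecidableEq ι] [Fintype X] (i : ι)
    (P : X → Prop) [DecidablePred P] :
    #{g : ι → X | P (g i)} * Fintype.card X = #{x | P x} * Fintype.card (ι → X) := by
  have h : #{g : ι → X | P (g i)} = #{x | P x} * Fintype.card ({j // j ≠ i} → X) := by
    rw [← card_univ, ← card_product]
    refine card_equiv (Equiv.funSplitAt i X) fun g => ?_
    simp
  rw [h, Fintype.card_congr (Equiv.funSplitAt i X), Fintype.card_prod]
  ring

theorem prob_le_ofReal {n φ nc : ℕ} (hnc : nc ≤ n) (E : Set (Sampling n φ nc))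
    [DecidablePred (· ∈ E)] {δ : ℝ}
    (h : (#{com | com ∈ E} : ℝ) ≤ δ * Fintype.card (Sampling n φ nc)) :
    prob φ hnc E ≤ ENNReal.ofReal δ := by
  have := Sampling.nonempty φ hnc
  have hpos : (0 : ℝ) < Fintype.card (Sampling n φ nc) := by exact_mod_cast Fintype.card_pos
  rw [prob, samplingLaw, PMF.toOuterMeasure_uniformOfFintype_apply,
    ← ENNReal.ofReal_natCast, ← ENNReal.ofReal_natCast, ← ENNReal.ofReal_div_of_pos hpos]
  refine ENNReal.ofReal_le_ofReal ?_
  rw [div_le_iff₀ hpos, Fintype.card_subtype]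
  exact h

theorem prob_committee_le {n φ nc : ℕ} (hnc : nc ≤ n) (Byz : Finset (Fin n))
    (hB : 3 * Byz.card ≤ n) (i : Fin n) (k : Fin φ) :
    prob φ hnc {com | nc ≤ 2 * #((com i k).1 ∩ Byz)} ≤ ENNReal.ofReal (Real.exp (-(nc / 18))) := by
  classical
  let X := {S : Finset (Fin n) // S.card = nc}
  have hcard : Fintype.card X = n.choose nc := by
    simp [X]
  have hXpos : (0 : ℝ) < Fintype.card X := by
    rw [hcard]; exact_mod_cast Nat.choose_pos hnc
  have hXbad : (#{S : X | nc ≤ 2 * #(S.1 ∩ Byz)} : ℝ) ≤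
      Real.exp (-(nc / 18)) * Fintype.card X := by
    rw [hcard]
    refine le_trans (le_of_eq ?_) (card_filter_le_two_mul_card_inter_le Byz hB)
    congr 1
    refine card_bij (fun S _ => S.1) (fun S hS => ?_) (fun S _ S' _ h => Subtype.ext h)
      fun S hS => ?_
    · simpa [S.2] using hS
    · simp only [mem_filter, mem_powersetCard, subset_univ, true_and] at hS
      exact ⟨⟨S, hS.1⟩, by simpa using hS.2, rfl⟩
  refine prob_le_ofReal hnc _ ?_
  -- A sampling is a function of two successive arguments, so a single committee is isolated in two
  -- stages.
  have h1 := card_pi_apply_mul_card k fun S : X => nc ≤ 2 * #(S.1 ∩ Byz)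
  have h2 := card_pi_apply_mul_card i fun g : Fin φ → X => nc ≤ 2 * #((g k).1 ∩ Byz)
  have := Sampling.nonempty φ hnc
  have hpos : (0 : ℝ) < Fintype.card (Fin φ → X) := by
    rw [Fintype.card_fun]; push_cast; positivity
  replace h1 := congrArg (Nat.cast : ℕ → ℝ) h1
  replace h2 := congrArg (Nat.cast : ℕ → ℝ) h2
  simp only [Nat.cast_mul] at h1 h2
  refine le_of_mul_le_mul_right ?_ (mul_pos hXpos hpos)
  calc (#{com : Sampling n φ nc | nc ≤ 2 * #((com i k).1 ∩ Byz)} : ℝ) *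
        (Fintype.card X * Fintype.card (Fin φ → X))
      = #{com : Fin n → Fin φ → X | nc ≤ 2 * #((com i k).1 ∩ Byz)} *
        Fintype.card (Fin φ → X) * Fintype.card X := by ring
    _ = #{S : X | nc ≤ 2 * #(S.1 ∩ Byz)} *
        (Fintype.card (Fin φ → X) * Fintype.card (Fin n → Fin φ → X)) := by
        rw [h2, mul_right_comm, h1]; ring
    _ ≤ Real.exp (-(nc / 18)) * Fintype.card X *
        (Fintype.card (Fin φ → X) * Fintype.card (Fin n → Fin φ → X)) := by gcongr
    _ = _ := by ring

theorem ofReal_le_prob_honestMajority {n φ nc : ℕ} [NeZero φ] (hnc : nc ≤ n)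
    (Byz : Finset (Fin n)) (hn : 0 < n) (hB : 3 * Byz.card ≤ n) {ε : ℝ} (hε : 0 < ε)
    (h : 18 * Real.log (n * φ / ε) ≤ nc) :
    ENNReal.ofReal (1 - ε) ≤ prob φ hnc {com | HonestMajority Byz com} := by
  have hnφ : (0 : ℝ) < n * φ :=
    mul_pos (by exact_mod_cast hn) (by exact_mod_cast Nat.pos_of_ne_zero (NeZero.ne φ))
  have hsmall : n * φ * Real.exp (-(nc / 18)) ≤ ε := by
    have h1 : Real.log (n * φ / ε) ≤ nc / 18 := by linarith
    rw [Real.log_le_iff_le_exp (by positivity), div_le_iff₀ hε] at h1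
    rw [Real.exp_neg, ← div_eq_mul_inv, div_le_iff₀ (Real.exp_pos _), mul_comm ε]
    exact h1
  -- A committee without honest majority has at least half of its `nc` members in `Byz`. Covering
  -- the whole space lets subadditivity alone give the lower bound.
  have hcover : (Set.univ : Set (Sampling n φ nc)) ⊆ {com | HonestMajority Byz com} ∪
      ⋃ x : Fin n × Fin φ, {com | nc ≤ 2 * #((com x.1 x.2).1 ∩ Byz)} := by
    intro com _
    by_cases hc : HonestMajority Byz com
    · exact .inl hc
    · right
      simp only [HonestMajority, not_forall, not_lt] at hc
      obtain ⟨i, k, hik⟩ := hc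
      refine Set.mem_iUnion.2 ⟨(i, k), ?_⟩
      have h1 := card_sdiff_add_card_inter (com i k).1 Byz
      have h2 := (com i k).2
      change nc ≤ 2 * #((com i k).1 ∩ Byz)
      omega
  have hone : prob φ hnc (Set.univ : Set (Sampling n φ nc)) = 1 := by
    rw [prob, PMF.toOuterMeasure_apply_eq_one_iff]
    exact Set.subset_univ _
  have hbad : prob φ hnc (⋃ x : Fin n × Fin φ, {com | nc ≤ 2 * #((com x.1 x.2).1 ∩ Byz)}) ≤
      ENNReal.ofReal ε := by
    calc _ ≤ ∑ x : Fin n × Fin φ, prob φ hnc {com | nc ≤ 2 * #((com x.1 x.2).1 ∩ Byz)} :=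
          MeasureTheory.measure_iUnion_fintype_le _ _
      _ ≤ ∑ _x : Fin n × Fin φ, ENNReal.ofReal (Real.exp (-(nc / 18))) :=
          sum_le_sum fun x _ => prob_committee_le hnc Byz hB x.1 x.2
      _ = ENNReal.ofReal (n * φ * Real.exp (-(nc / 18))) := by
          rw [sum_const, card_univ, Fintype.card_prod, Fintype.card_fin, Fintype.card_fin,
            ENNReal.ofReal_mul hnφ.le, nsmul_eq_mul, ← Nat.cast_mul, ENNReal.ofReal_natCast]
      _ ≤ ENNReal.ofReal ε := ENNReal.ofReal_le_ofReal hsmall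
  rw [ENNReal.ofReal_sub _ hε.le, ENNReal.ofReal_one, tsub_le_iff_right, ← hone]
  calc _ ≤ prob φ hnc _ := MeasureTheory.measure_mono hcover
    _ ≤ _ := (MeasureTheory.measure_union_le _ _).trans (add_le_add_right hbad _)

theorem honestMajority_subset_validityEvent {V D : Type*} {n f φ nc : ℕ} [NeZero φ]
    (hf : 3 * f < n) (hash : Msg n V D → D) (Byz : Finset (Fin n)) (hByz : Byz.card ≤ f) :
    {com | HonestMajority Byz com} ⊆ ValidityEvent f φ nc hash Byz := by
  intro com hcom input σ hσ
  refine hσ.validity (fun i r => hcom i (Fin.ofNat φ r)) ?_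
  have h : (univ \ Byz).card = n - Byz.card := by
    rw [card_sdiff_of_subset (subset_univ _), card_univ, Fintype.card_fin]
  -- At least `n - f` nodes are honest, and `3 * f < n`.
  change 2 * f + 1 ≤ (univ \ Byz).card
  omega

end APMBRB

theorem mainTheorem4 {V D : Type*} (n f φ nc : ℕ) [NeZero φ] (hf : 3 * f < n) (hnc : nc ≤ n)
    (hash : APMBRB.Msg n V D → D) (Byz : Finset (Fin n)) (hByz : Byz.card ≤ f)
    (ε : ℝ) (hε : 0 < ε) :
    (ENNReal.ofReal (1 - ε) ≤ APMBRB.prob φ hnc {com | APMBRB.HonestMajority Byz com} →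
      ENNReal.ofReal (1 - ε) ≤ APMBRB.prob φ hnc (APMBRB.ValidityEvent f φ nc hash Byz)) ∧
    (18 * Real.log (n * φ / ε) ≤ nc →
      ENNReal.ofReal (1 - ε) ≤ APMBRB.prob φ hnc (APMBRB.ValidityEvent f φ nc hash Byz)) := by
  have h : ENNReal.ofReal (1 - ε) ≤ APMBRB.prob φ hnc {com | APMBRB.HonestMajority Byz com} →
      ENNReal.ofReal (1 - ε) ≤ APMBRB.prob φ hnc (APMBRB.ValidityEvent f φ nc hash Byz) :=
    fun h => h.trans (MeasureTheory.measure_mono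
      (APMBRB.honestMajority_subset_validityEvent hf hash Byz hByz))
  exact ⟨h, fun hlog => h (APMBRB.ofReal_le_prob_honestMajority hnc Byz (by omega) (by omega)
    hε hlog)⟩
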